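/- **Setting.** $\|\cdot\|$ is the Euclidean norm on $\mathbb R^d$ and $\mathbb B_r(z)$ the closed ball of radius $r$ centred at $z$. A map $(\lambda,\delta,\bar x)\mapsto \mathcal O_{\lambda,\delta}(\bar x)\in\mathbb R^d$ is an *$r$-BROO* (ball regularized optimization oracle) for $f:\mathbb R^d\to\mathbb R$ if for all $\lambda,\delta>0$ and $\bar x\in\mathbb R^d$ the point $\tilde x=\mathcal O_{\lambda,\delta}(\bar x)$ satisfies $$f(\tilde x)+\tfrac\lambda2\|\tilde x-\bar x\|^2\le\min_{x\in\mathbb B_r(\bar x)}\Big\{f(x)+\tfrac\lambda2\|x-\bar x\|^2\Big\}+\tfrac\lambda2\delta^2 .$$ **Algorithm (BROO acceleration).** Input: $x_0\in\mathbb R^d$, $L_f,R,r,\epsilon>0$ and an $r$-BROO $\mathcal O$. Set $v_0=x_0$, $A_0=0$. For $t=0,1,2,\dots$: - $\lambda_{t+1}=\textsc{Bisection}(x_t,v_t,A_t)$ with $\lambda_{\max}=\frac{2L_f}{r}$, $\lambda_{\min}=\frac{\epsilon}{6rR}$; - $a_{t+1}=\frac1{2\lambda_{t+1}}\big(1+\sqrt{1+4\lambda_{t+1}A_t}\big)$,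 $A_{t+1}=A_t+a_{t+1}$, $y_t=\frac{A_t}{A_{t+1}}x_t+\frac{a_{t+1}}{A_{t+1}}v_t$; - $x_{t+1}=\mathcal O_{\lambda_{t+1},\delta_{t+1}}(y_t)$ with $\delta_{t+1}=\frac{\epsilon}{12\lambda_{t+1}R}$; - $v_{t+1}=\operatorname{argmin}_{v\in\mathbb B_R(x_0)}\big\{a_{t+1}\lambda_{t+1}\langle y_t-x_{t+1},v\rangle+\frac12\|v-v_t\|^2\big\}$; - if $A_{t+1}\ge\frac{R^2}{\epsilon}$, or $\lambda_{t+1}\le\frac{\epsilon}{3rR}$, or $\|x_{t+1}-v_{t+1}\|>2R$, or $A_{t+1}<\exp\big(\frac{r^{2/3}}{R^{2/3}}(t-1)\big)A_1$, then return some point of $\operatorname{argmin}_{x\in\{x_0,\dots,x_{t+1}\}}f(x)$. $\textsc{Bisection}(x,v,A)$: put $\alpha_\tau=\frac{\tau}{1+\tau+\sqrt{1+2\tau}}$, $y_\lambda=\alpha_{2A\lambda}x+(1-\alpha_{2A\lambda})v$ and $\Delta(\lambda)=\|\mathcal O_{\lambda,r/17}(y_\lambda)-y_\lambda\|$. Start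 with $\lambda=\lambda_{\max}$; while $\lambda\ge\lambda_{\min}$ and $\Delta(\lambda)\le\frac{13r}{16}$, replace $\lambda$ by $\lambda/2$. If then $\lambda\le\lambda_{\min}$, return $2\lambda$. Otherwise, if $\Delta(\lambda)\le\frac{15r}{16}$, return $\lambda$. Otherwise let $\lambda_u=2\lambda$, $\lambda_\ell=\lambda$ and, throughout, $\lambda_m=\sqrt{\lambda_u\lambda_\ell}$; while $\Delta(\lambda_m)\notin[\frac{13r}{16},\frac{15r}{16}]$ and $\log_2\frac{\lambda_u}{\lambda_\ell}\ge\frac{r}{8(R+L_f/\lambda_\ell)}$, set $\lambda_u=\lambda_m$ if $\Delta(\lambda_m)<\frac{13r}{16}$ and $\lambda_\ell=\lambda_m$ if not. Return $\lambda_m$. **Theorem.** There are universal constants $C,c>0$ such that the following holds for every $d$, every convex and $L_f$-Lipschitz $f:\mathbb R^d\to\mathbb R$ with $L_f>0$, all $R>0$, $r\in(0,R]$, $\epsilon>0$, $x_0\in\mathbb R^d$ and every $r$-BROO for $f$. Let $f_*=\min_{z\in\mathbb B_R(x_0)}f(z)$. The algorithm terminates, and for every way of breaking the ties in the final argmin: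 - the returned point $x$ satisfies $f(x)-f_*\le\epsilon$; - if $(\lambda_{(1)},\delta_{(1)}),\dots,(\lambda_{(T)},\delta_{(T)})$ are the parameters of all the oracle queries made, in the bisections and in the main loop, then $$T\le C\Big(\frac Rr\Big)^{2/3}\Big(1+\log\frac{\max\{f(x_0)-f_*,\,\epsilon\}\,R}{\epsilon r}\Big)\Big(1+\max\Big\{0,\log\frac{L_fR^2}{\epsilon r}\Big\}\Big);$$ - $\lambda_{(i)}\le C\frac{L_f}{r}$ and $\delta_{(i)}\ge c\,\frac{\epsilon}{\lambda_{(i)}R}$ for all $i\le T$; - if moreover $\epsilon\le L_fR$, then $\lambda_{(i)}\ge c\,\frac{\epsilon}{rR}$ for all $i\le T$, and $$\sum_{i\le T}\frac1{\sqrt{\lambda_{(i)}}}\le C\,\frac{R}{\sqrt\epsilon}\Big(1+\log\frac{L_fR^2}{\epsilon r}\Big).$$ -/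

import Mathlib

open scoped NNReal

noncomputable section

namespace BrooAccel

/-- The `d`-dimensional Euclidean space. -/
abbrev Pt (d : ℕ) := EuclideanSpace ℝ (Fin d)

/-- `min_{z ∈ 𝔹_R(x₀)} f z` (attained for the continuous functions `f` considered here,
since the closed ball is nonempty and compact). -/
def ballMin {d : ℕ} (f : Pt d → ℝ) (x₀ : Pt d) (R : ℝ) : ℝ :=
  sInf (f '' Metric.closedBall x₀ R)

/-- `O lam δ xbar` is the answer to the query point `xbar` with regularization parameter `lam` and
accuracy `δ`.  The map `O` is an `r`-BROO (ball regularized optimization oracle) for `f` if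
`f x' + (lam / 2) ‖x' - xbar‖ ^ 2 ≤ min_{x ∈ 𝔹_r(xbar)} (f x + (lam / 2) ‖x - xbar‖ ^ 2)
  + (lam / 2) δ ^ 2` for every answer `x' = O lam δ xbar`.
The answer itself is not required to lie in the ball. -/
def IsBROO {d : ℕ} (r : ℝ) (f : Pt d → ℝ) (O : ℝ → ℝ → Pt d → Pt d) : Prop :=
  ∀ (lam δ : ℝ) (xbar : Pt d), 0 < lam → 0 < δ →
    ∀ x ∈ Metric.closedBall xbar r,
      f (O lam δ xbar) + lam / 2 * ‖O lam δ xbar - xbar‖ ^ 2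
        ≤ f x + lam / 2 * ‖x - xbar‖ ^ 2 + lam / 2 * δ ^ 2

/-- The parameters of one oracle query: regularization `lam` and accuracy `acc`. -/
structure Query where
  lam : ℝ
  acc : ℝ

/-! ### The subroutine `λ`-Bisection -/

/-- `α_τ = τ / (1 + τ + √(1 + 2 τ))`. -/
def alpha (τ : ℝ) : ℝ := τ / (1 + τ + √(1 + 2 * τ))

/-- `y_lam = α_{2 A lam} x + (1 - α_{2 A lam}) v`. -/
def bisectPoint {d : ℕ} (x v : Pt d) (A lam : ℝ) : Pt d :=
  alpha (2 * A * lam) • x + (1 - alpha (2 * A * lam)) • v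

/-- `Δ(lam) = ‖O_{lam, r/17}(y_lam) - y_lam‖`. -/
def bisectGap {d : ℕ} (O : ℝ → ℝ → Pt d → Pt d) (r : ℝ) (x v : Pt d) (A lam : ℝ) : ℝ :=
  ‖O lam (r / 17) (bisectPoint x v A lam) - bisectPoint x v A lam‖

/-- First loop: `while lam ≥ lamMin and Δ(lam) ≤ 13 r / 16 do lam ← lam / 2`.
`HalvingLoop Δ r lamMin lam out qs` says that the loop, entered with the value `lam`, terminates
with the value `out` after having made the oracle queries `qs`. -/
inductive HalvingLoop (Δ : ℝ → ℝ) (r lamMin : ℝ) : ℝ → ℝ → List Query → Prop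
  | small {lam : ℝ} (h : lam < lamMin) : HalvingLoop Δ r lamMin lam lam []
  | far {lam : ℝ} (h : lamMin ≤ lam) (hΔ : 13 * r / 16 < Δ lam) :
      HalvingLoop Δ r lamMin lam lam [⟨lam, r / 17⟩]
  | halve {lam out : ℝ} {qs : List Query} (h : lamMin ≤ lam) (hΔ : Δ lam ≤ 13 * r / 16)
      (next : HalvingLoop Δ r lamMin (lam / 2) out qs) :
      HalvingLoop Δ r lamMin lam out (⟨lam, r / 17⟩ :: qs)

/-- Second loop, with `lamM = √(lamU lamL)` throughout:
`while Δ(lamM) ∉ [13 r / 16, 15 r / 16] and log₂ (lamU / lamL) ≥ r / (8 (R + Lf / lamL)) do`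
`if Δ(lamM) < 13 r / 16 then lamU ← lamM else lamL ← lamM`.
`SearchLoop Δ r R Lf lamL lamU out qs` says that the loop, entered with the values `lamL` and
`lamU`, terminates with `lamM = out` after having made the oracle queries `qs`. -/
inductive SearchLoop (Δ : ℝ → ℝ) (r R Lf : ℝ) : ℝ → ℝ → ℝ → List Query → Prop
  | inside {lamL lamU : ℝ}
      (h : Δ √(lamU * lamL) ∈ Set.Icc (13 * r / 16) (15 * r / 16)) :
      SearchLoop Δ r R Lf lamL lamU √(lamU * lamL) [⟨√(lamU * lamL), r / 17⟩]
  | narrow {lamL lamU : ℝ}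
      (h : Δ √(lamU * lamL) ∉ Set.Icc (13 * r / 16) (15 * r / 16))
      (hlog : Real.logb 2 (lamU / lamL) < r / (8 * (R + Lf / lamL))) :
      SearchLoop Δ r R Lf lamL lamU √(lamU * lamL) [⟨√(lamU * lamL), r / 17⟩]
  | lowerU {lamL lamU out : ℝ} {qs : List Query}
      (h : Δ √(lamU * lamL) ∉ Set.Icc (13 * r / 16) (15 * r / 16))
      (hlog : r / (8 * (R + Lf / lamL)) ≤ Real.logb 2 (lamU / lamL))
      (hΔ : Δ √(lamU * lamL) < 13 * r / 16)
      (next : SearchLoop Δ r R Lf lamL √(lamU * lamL) out qs) :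
      SearchLoop Δ r R Lf lamL lamU out (⟨√(lamU * lamL), r / 17⟩ :: qs)
  | raiseL {lamL lamU out : ℝ} {qs : List Query}
      (h : Δ √(lamU * lamL) ∉ Set.Icc (13 * r / 16) (15 * r / 16))
      (hlog : r / (8 * (R + Lf / lamL)) ≤ Real.logb 2 (lamU / lamL))
      (hΔ : ¬ Δ √(lamU * lamL) < 13 * r / 16)
      (next : SearchLoop Δ r R Lf √(lamU * lamL) lamU out qs) :
      SearchLoop Δ r R Lf lamL lamU out (⟨√(lamU * lamL), r / 17⟩ :: qs)

/-- `Bisection Δ r R Lf lamMax lamMin out qs`: the subroutine terminates, returns `out`, and its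
oracle queries are `qs`, in this order.  A value `Δ(lam)` that is used again right after having been
computed is cached and not queried again. -/
inductive Bisection (Δ : ℝ → ℝ) (r R Lf lamMax lamMin : ℝ) : ℝ → List Query → Prop
  | boundary {lam : ℝ} {qs : List Query} (h₁ : HalvingLoop Δ r lamMin lamMax lam qs)
      (h : lam ≤ lamMin) :
      Bisection Δ r R Lf lamMax lamMin (2 * lam) qs
  | early {lam : ℝ} {qs : List Query} (h₁ : HalvingLoop Δ r lamMin lamMax lam qs)
      (h : ¬ lam ≤ lamMin) (hΔ : Δ lam ≤ 15 * r / 16) :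
      Bisection Δ r R Lf lamMax lamMin lam qs
  | search {lam out : ℝ} {qs qs' : List Query} (h₁ : HalvingLoop Δ r lamMin lamMax lam qs)
      (h : ¬ lam ≤ lamMin) (hΔ : ¬ Δ lam ≤ 15 * r / 16)
      (h₂ : SearchLoop Δ r R Lf lam (2 * lam) out qs') :
      Bisection Δ r R Lf lamMax lamMin out (qs ++ qs')

/-! ### The main loop -/

/-- The values of the variables during an execution of the main loop; `bisQueries t` lists the
queries of the bisection called in iteration `t`.  Only the indices that the execution reaches
matter. -/
structure Trace (d : ℕ) where
  x : ℕ → Pt d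
  v : ℕ → Pt d
  y : ℕ → Pt d
  A : ℕ → ℝ
  a : ℕ → ℝ
  lam : ℕ → ℝ
  bisQueries : ℕ → List Query

/-- `δ_t = ε / (12 lam_t R)`. -/
def Trace.acc {d : ℕ} (τ : Trace d) (R ε : ℝ) (t : ℕ) : ℝ := ε / (12 * τ.lam t * R)

/-- The trace follows the body of the main loop in iteration `t`. -/
structure Trace.IsStep {d : ℕ} (τ : Trace d) (O : ℝ → ℝ → Pt d → Pt d) (Lf R r ε : ℝ)
    (x₀ : Pt d) (t : ℕ) : Prop where
  lam_eq : Bisection (bisectGap O r (τ.x t) (τ.v t) (τ.A t)) r R Lf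
    (2 * Lf / r) (ε / (6 * r * R)) (τ.lam (t + 1)) (τ.bisQueries t)
  a_eq : τ.a (t + 1) = 1 / (2 * τ.lam (t + 1)) * (1 + √(1 + 4 * τ.lam (t + 1) * τ.A t))
  A_eq : τ.A (t + 1) = τ.A t + τ.a (t + 1)
  y_eq : τ.y t = (τ.A t / τ.A (t + 1)) • τ.x t + (τ.a (t + 1) / τ.A (t + 1)) • τ.v t
  x_eq : τ.x (t + 1) = O (τ.lam (t + 1)) (τ.acc R ε (t + 1)) (τ.y t)
  v_mem : τ.v (t + 1) ∈ Metric.closedBall x₀ R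
  v_min : IsMinOn
    (fun w => τ.a (t + 1) * τ.lam (t + 1) * inner ℝ (τ.y t - τ.x (t + 1)) w
      + 1 / 2 * ‖w - τ.v t‖ ^ 2)
    (Metric.closedBall x₀ R) (τ.v (t + 1))

/-- The stopping test at the end of iteration `t`. -/
def Trace.Stops {d : ℕ} (τ : Trace d) (R r ε : ℝ) (t : ℕ) : Prop :=
  R ^ 2 / ε ≤ τ.A (t + 1) ∨
  τ.lam (t + 1) ≤ ε / (3 * r * R) ∨
  2 * R < ‖τ.x (t + 1) - τ.v (t + 1)‖ ∨
  τ.A (t + 1) < Real.exp (r ^ (2 / 3 : ℝ) / R ^ (2 / 3 : ℝ) * ((t : ℝ) - 1)) * τ.A 1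

/-- All queries of iteration `t`, in this order: those of the bisection, then the one that
produces `x_{t+1}`. -/
def Trace.queries {d : ℕ} (τ : Trace d) (R ε : ℝ) (t : ℕ) : List Query :=
  τ.bisQueries t ++ [⟨τ.lam (t + 1), τ.acc R ε (t + 1)⟩]

/-- `Returns f O Lf R r ε x₀ xret qs`: BROO acceleration, started at `x₀`, terminates and returns
`xret`, and `qs` lists the parameters of all its oracle queries in the order in which they are
made.  The number `N` is the last iteration; ties in the final argmin may be broken in any way. -/
def Returns {d : ℕ} (f : Pt d → ℝ) (O : ℝ → ℝ → Pt d → Pt d) (Lf R r ε : ℝ) (x₀ : Pt d)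
    (xret : Pt d) (qs : List Query) : Prop :=
  ∃ (N : ℕ) (τ : Trace d),
    τ.x 0 = x₀ ∧ τ.v 0 = x₀ ∧ τ.A 0 = 0 ∧
    (∀ t ≤ N, τ.IsStep O Lf R r ε x₀ t) ∧
    (∀ t < N, ¬ τ.Stops R r ε t) ∧
    τ.Stops R r ε N ∧
    (∃ i ≤ N + 1, xret = τ.x i) ∧ (∀ i ≤ N + 1, f xret ≤ f (τ.x i)) ∧
    qs = (List.range (N + 1)).flatMap (τ.queries R ε)

end BrooAccel

end

/-! Write `p` for the exact proximal point of `y` with parameter `λ`, so that `λ (y - p)` is a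
subgradient of `f` at `p`. The method is an inexact accelerated proximal point method, and the
bisection makes each proximal displacement comparable to `r`. Let `u` minimize `f` on the ball and
suppose that every iterate has gap more than `ε`; the aim is to contradict the stopping test.

Bisection. A query whose answer moves at most `15r/16` certifies `‖y - p‖ < r` (`IsBROO.norm_lt`),
and inside the ball the answer is within its accuracy of `p`. Since the displacement varies in a
controlled way with `λ` (`norm_bisectPoint_sub_prox_le`), a short enough bracket pins it down: the
returned `λ` has `‖y - p‖ < r`, and `‖y - p‖ ≥ 3r/4` unless the search reached the bottom of its
range (`Bisection.norm_spec`).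

Potential. Each step above that bottom decreases `A (f x - f u) + ‖v - u‖² / 2` by at least `(r² /
4) λ A'`, up to an error `a ε / 6`, where `a` is the step coefficient and `A' = A + a`
(`Trace.IsStep.potential`). While the gap is at least `ε`, summation gives `Σ λ A' ≤ 2 R² / r²` and
keeps `v` within `R` of `u`; a separate proximal estimate keeps `x` there too. As `λ a² = A'`, the
relative increment `a / A'` equals `(λ A') ^ (-1/2)`, so the bound on the sum forces exponential
growth of `A` at rate `(r / R) ^ (2/3)` (`Trace.Run.exp_mul_le`). Hence slow growth or `‖x - v‖ >
2R` contradicts the gap; large `A` gives a good point by the potential, and small `λ` by the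
proximal inequality (`Trace.Run.exists_gap_le`).

Complexity. Growth is itself tested, so it holds in every continuing iteration, and `A < R² / ε`
bounds their number once `A 1 = 1 / λ₁` is bounded below. Each bisection costs logarithmically many
queries. Finally, `1 / √λ` telescopes against `2 √A`, and one bisection costs only a logarithmic
factor times `1 / √λ` of its output. If `ε` is so large that the bisection range is empty, the
starting point is already good. -/

noncomputable section

namespace BrooAccel

/-! ### Exact proximal points: existence, monotonicity and stability -/

section Prox

variable {E : Type*} [NormedAddCommGroup E] [InnerProductSpace ℝ E]

/-- `p` is the proximal point of `f` at `y` with regularization `lam`, expressed through the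
optimality condition that `lam • (y - p)` is a subgradient of `f` at `p`. -/
def IsProx (f : E → ℝ) (lam : ℝ) (y p : E) : Prop :=
  ∀ u, f p + lam * inner ℝ (y - p) (u - p) ≤ f u

theorem IsProx.quadratic_growth {f : E → ℝ} {lam : ℝ} {y p : E} (h : IsProx f lam y p) (z : E) :
    f p + lam / 2 * ‖p - y‖ ^ 2 + lam / 2 * ‖z - p‖ ^ 2 ≤ f z + lam / 2 * ‖z - y‖ ^ 2 := by
  have h1 := h z
  have h2 : ‖z - y‖ ^ 2 = ‖z - p‖ ^ 2 - 2 * inner ℝ (y - p) (z - p) + ‖p - y‖ ^ 2 := by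
    rw [show z - y = (z - p) - (y - p) by abel, norm_sub_sq_real, norm_sub_rev p y,
      real_inner_comm]
  rw [h2]
  linarith

/-- Replaces the limit `t → 0` when first-order conditions are derived from minimality along a
segment. -/
theorem nonneg_of_forall_add_mul_nonneg {b K : ℝ}
    (h : ∀ t : ℝ, 0 < t → t ≤ 1 → 0 ≤ b + t * K) : 0 ≤ b := by
  by_contra! hb
  have h1 := h 1 one_pos le_rfl
  have hK : 0 < K := by linarith
  have h2 := h (-b / (2 * K)) (div_pos (by linarith) (by positivity))
    (by rw [div_le_one (by positivity)]; linarith)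
  have h3 : -b / (2 * K) * K = -b / 2 := by field_simp
  linarith

theorem isProx_of_forall_le {f : E → ℝ} (hf : ConvexOn ℝ Set.univ f) {lam : ℝ} {y p : E}
    (hmin : ∀ z, f p + lam / 2 * ‖p - y‖ ^ 2 ≤ f z + lam / 2 * ‖z - y‖ ^ 2) :
    IsProx f lam y p := by
  intro u
  rw [← sub_nonneg]
  refine nonneg_of_forall_add_mul_nonneg (K := lam / 2 * ‖u - p‖ ^ 2) fun t ht0 ht1 => ?_
  have h1 := hmin (p + t • (u - p))
  have h2 : f (p + t • (u - p)) ≤ (1 - t) * f p + t * f u := by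
    have := hf.2 (Set.mem_univ p) (Set.mem_univ u) (by linarith : 0 ≤ 1 - t) ht0.le (by ring)
    rw [show p + t • (u - p) = (1 - t) • p + t • u by module]
    simpa using this
  have h3 : ‖p + t • (u - p) - y‖ ^ 2
      = t ^ 2 * ‖u - p‖ ^ 2 - 2 * (t * inner ℝ (y - p) (u - p)) + ‖p - y‖ ^ 2 := by
    rw [show p + t • (u - p) - y = t • (u - p) - (y - p) by abel, norm_sub_sq_real,
      norm_sub_rev p y, norm_smul, inner_smul_left, real_inner_comm, mul_pow]
    simp
  rw [h3] at h1
  refine nonneg_of_mul_nonneg_right ?_ ht0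
  linarith

theorem exists_isProx [ProperSpace E] {f : E → ℝ} (hf : ConvexOn ℝ Set.univ f) {Lf : ℝ≥0}
    (hL : LipschitzWith Lf f) {lam : ℝ} (hlam : 0 < lam) (y : E) : ∃ p, IsProx f lam y p := by
  have hcont : Continuous fun z => f z + lam / 2 * ‖z - y‖ ^ 2 := by
    have := hL.continuous
    fun_prop
  -- Beyond this radius the quadratic term exceeds any decrease that the Lipschitz bound allows, so
  -- a minimizer on the ball is global.
  have hρ : 0 ≤ 2 * Lf / lam := by positivity
  obtain ⟨p, -, hp⟩ := (isCompact_closedBall y (2 * Lf / lam)).exists_isMinOn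
    ⟨y, Metric.mem_closedBall_self hρ⟩ hcont.continuousOn
  refine ⟨p, isProx_of_forall_le hf fun z => ?_⟩
  by_cases hz : z ∈ Metric.closedBall y (2 * Lf / lam)
  · exact hp hz
  · have h1 : f p + lam / 2 * ‖p - y‖ ^ 2 ≤ f y + lam / 2 * ‖y - y‖ ^ 2 :=
      hp (Metric.mem_closedBall_self hρ)
    rw [Metric.mem_closedBall, not_le, dist_eq_norm, div_lt_iff₀ hlam] at hz
    have h2 : f y - f z ≤ Lf * ‖z - y‖ := by
      have := hL.dist_le_mul y z
      rw [Real.dist_eq, dist_eq_norm, norm_sub_rev] at this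
      exact (le_abs_self _).trans this
    have h3 : 0 ≤ ‖z - y‖ := norm_nonneg _
    simp only [sub_self, norm_zero] at h1
    nlinarith

theorem IsProx.mul_norm_le {f : E → ℝ} {Lf : ℝ≥0} (hL : LipschitzWith Lf f) {lam : ℝ} {y p : E}
    (h : IsProx f lam y p) : lam * ‖y - p‖ ≤ Lf := by
  have h1 := h y
  rw [real_inner_self_eq_norm_sq] at h1
  have h2 : f y - f p ≤ Lf * ‖y - p‖ := by
    have := hL.dist_le_mul y p
    rw [Real.dist_eq, dist_eq_norm] at this
    exact (le_abs_self _).trans this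
  rcases (norm_nonneg (y - p)).eq_or_lt with h0 | h0
  · rw [← h0]; simp
  · refine le_of_mul_le_mul_right ?_ h0
    nlinarith

/-- The gradients of the Moreau envelopes are monotone in the proximal points. -/
theorem IsProx.inner_nonneg {f : E → ℝ} {lam lam' : ℝ} {y y' p p' : E} (h : IsProx f lam y p)
    (h' : IsProx f lam' y' p') :
    0 ≤ inner ℝ (lam • (y - p) - lam' • (y' - p')) (p - p') := by
  have h1 := h p'
  have h2 := h' p
  rw [inner_sub_left, inner_smul_left, inner_smul_left]
  have h3 : inner ℝ (y - p) (p' - p) = -inner ℝ (y - p) (p - p') := by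
    rw [← inner_neg_right, neg_sub]
  rw [h3] at h1
  simp only [conj_trivial]
  linarith

/-- The proximal displacement is nonexpansive. -/
theorem IsProx.norm_sub_sub_le {f : E → ℝ} {lam : ℝ} (hlam : 0 < lam) {y y' p p' : E}
    (h : IsProx f lam y p) (h' : IsProx f lam y' p') :
    ‖(y - p) - (y' - p')‖ ≤ ‖y - y'‖ := by
  have h1 := h.inner_nonneg h'
  rw [← smul_sub, inner_smul_left, show p - p' = (y - y') - ((y - p) - (y' - p')) by abel,
    inner_sub_right _ (y - y'), real_inner_self_eq_norm_sq] at h1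
  have h2 := real_inner_le_norm ((y - p) - (y' - p')) (y - y')
  have h3 := nonneg_of_mul_nonneg_right h1 (by simpa using hlam)
  rcases (norm_nonneg ((y - p) - (y' - p'))).eq_or_lt with h0 | h0
  · rw [← h0]; positivity
  · refine le_of_mul_le_mul_left ?_ h0
    nlinarith

/-- The gradient norm of the Moreau envelope grows with the parameter. With displacement norms `s`
and `s'`, monotonicity of the subgradients and Cauchy–Schwarz give `(lam s - lam' s') (s' - s) ≥ 0`.
-/
theorem IsProx.norm_le_of_le {f : E → ℝ} {lam lam' : ℝ} (hlam : 0 < lam) (hle : lam ≤ lam')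
    {y p p' : E} (h : IsProx f lam y p) (h' : IsProx f lam' y p') :
    lam * ‖y - p‖ ≤ lam' * ‖y - p'‖ := by
  have h1 := h.inner_nonneg h'
  rw [show p - p' = (y - p') - (y - p) by abel] at h1
  have h2 := real_inner_le_norm (y - p) (y - p')
  have h3 : inner ℝ (lam • (y - p) - lam' • (y - p')) ((y - p') - (y - p))
      = (lam + lam') * inner ℝ (y - p) (y - p') - lam * ‖y - p‖ ^ 2 - lam' * ‖y - p'‖ ^ 2 := by
    generalize y - p = a
    generalize y - p' = b
    simp only [inner_sub_left, inner_sub_right, real_inner_smul_left, real_inner_self_eq_norm_sq,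
      real_inner_comm a b]
    ring
  rw [h3] at h1
  by_contra! hlt
  have h4 : ‖y - p'‖ < ‖y - p‖ := by
    by_contra! h5
    have := norm_nonneg (y - p)
    nlinarith
  nlinarith [mul_pos (sub_pos.2 hlt) (sub_pos.2 h4)]

/-- Passes through the proximal point of `y` with parameter `lam'`: changing the parameter is
controlled by the previous lemma and the Lipschitz bound, changing the centre by nonexpansiveness.
-/
theorem IsProx.norm_le_add [ProperSpace E] {f : E → ℝ} (hf : ConvexOn ℝ Set.univ f) {Lf : ℝ≥0}
    (hL : LipschitzWith Lf f) {lam lam' : ℝ} (hlam : 0 < lam) (hle : lam ≤ lam')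
    {y y' p p' : E} (h : IsProx f lam y p) (h' : IsProx f lam' y' p') :
    ‖y - p‖ ≤ ‖y' - p'‖ + ‖y - y'‖ + (1 - lam / lam') * (Lf / lam) := by
  have hlam' : 0 < lam' := hlam.trans_le hle
  obtain ⟨z, hz⟩ := exists_isProx hf hL hlam' y
  have h1 := h.norm_le_of_le hlam hle hz
  have h2 := hz.norm_sub_sub_le hlam' h'
  have h3 := hz.mul_norm_le hL
  have h4 := norm_sub_norm_le (y - z) (y' - p')
  have h5 : ‖y - p‖ - ‖y - z‖ ≤ (1 - lam / lam') * (Lf / lam) := by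
    have e : (1 - lam / lam') * (Lf / lam) = (lam' - lam) * Lf / (lam * lam') := by
      field_simp
    rw [e, le_div_iff₀ (by positivity)]
    nlinarith
  linarith

end Prox

/-! ### What an oracle answer reveals about the exact proximal point -/

section Oracle

variable {d : ℕ} {f : Pt d → ℝ} {r : ℝ} {O : ℝ → ℝ → Pt d → Pt d}

theorem IsBROO.norm_sub_le (hO : IsBROO r f O) {lam δ : ℝ} (hlam : 0 < lam) (hδ : 0 < δ)
    {y p : Pt d} (h : IsProx f lam y p) (hp : ‖y - p‖ ≤ r) : ‖O lam δ y - p‖ ≤ δ := by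
  have h1 := hO lam δ y hlam hδ p (by rwa [Metric.mem_closedBall, dist_comm, dist_eq_norm])
  have h2 := h.quadratic_growth (O lam δ y)
  refine le_of_sq_le_sq ?_ hδ.le
  refine le_of_mul_le_mul_left ?_ (half_pos hlam)
  linarith

/-- Otherwise the answer is at least `r/16` away from `p`. Moving it by `r/16` towards `p` stays in
the ball, and strong convexity makes the regularized objective drop by at least `(lam/2)(r/16)²`,
more than the tolerance `(lam/2)(r/17)²`. -/
theorem IsBROO.norm_lt (hf : ConvexOn ℝ Set.univ f) (hO : IsBROO r f O) (hr : 0 < r) {lam : ℝ}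
    (hlam : 0 < lam) {y p : Pt d} (h : IsProx f lam y p)
    (hΔ : ‖O lam (r / 17) y - y‖ ≤ 15 * r / 16) : ‖y - p‖ < r := by
  by_contra! hD
  set x := O lam (r / 17) y with hx
  have h1 : r / 16 ≤ ‖x - p‖ := by
    have := norm_sub_le_norm_sub_add_norm_sub y x p
    rw [norm_sub_rev y x] at this
    linarith
  set l := ‖x - p‖ with hl
  have hlpos : 0 < l := by linarith [div_pos hr (by norm_num : (0 : ℝ) < 16)]
  set s := r / 16 / l with hs
  have hs0 : 0 < s := by positivity
  have hs1 : s ≤ 1 := by rwa [hs, div_le_one hlpos]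
  have hsl : s * l = r / 16 := by rw [hs]; field_simp
  have hzn : ‖(x + s • (p - x)) - x‖ = r / 16 := by
    rw [add_sub_cancel_left, norm_smul, norm_sub_rev, ← hl, Real.norm_of_nonneg hs0.le, hsl]
  have hz : x + s • (p - x) ∈ Metric.closedBall y r := by
    rw [Metric.mem_closedBall, dist_eq_norm]
    have := norm_sub_le_norm_sub_add_norm_sub (x + s • (p - x)) x y
    linarith
  have h2 := hO lam (r / 17) y hlam (by positivity) _ hz
  rw [← hx] at h2
  have h3 : f (x + s • (p - x)) ≤ (1 - s) * f x + s * f p := by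
    have := hf.2 (Set.mem_univ x) (Set.mem_univ p) (by linarith : 0 ≤ 1 - s) hs0.le (by ring)
    rw [show x + s • (p - x) = (1 - s) • x + s • p by module]
    simpa using this
  have h4 : ‖x + s • (p - x) - y‖ ^ 2
      = (1 - s) * ‖x - y‖ ^ 2 + s * ‖p - y‖ ^ 2 - s * (1 - s) * l ^ 2 := by
    rw [show x + s • (p - x) - y = (1 - s) • (x - y) + s • (p - y) by module, hl,
      show x - p = (x - y) - (p - y) by abel]
    generalize x - y = a
    generalize p - y = b
    simp only [norm_add_sq_real, norm_sub_sq_real, norm_smul, inner_smul_left, inner_smul_right,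
      mul_pow, Real.norm_eq_abs, sq_abs, conj_trivial]
    ring
  have h5 := h.quadratic_growth x
  rw [h4] at h2
  rw [← hl] at h5
  have h6 : lam / 2 * (s * l) ^ 2 ≤ lam / 2 * (r / 17) ^ 2 := by
    have h7 : s * (lam / 2 * l ^ 2) ≤ s * (f x + lam / 2 * ‖x - y‖ ^ 2 - f p
      - lam / 2 * ‖p - y‖ ^ 2) := mul_le_mul_of_nonneg_left (by linarith) hs0.le
    have h8 : s * s * (lam / 2 * l ^ 2) ≤ s * (lam / 2 * l ^ 2) :=
      mul_le_mul_of_nonneg_right (by nlinarith) (by positivity)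
    nlinarith
  rw [hsl] at h6
  have h9 := le_of_mul_le_mul_left h6 (half_pos hlam)
  nlinarith [mul_pos hr hr]

theorem IsBROO.abs_norm_sub_le (hO : IsBROO r f O) {lam δ : ℝ} (hlam : 0 < lam) (hδ : 0 < δ)
    {y p : Pt d} (h : IsProx f lam y p) (hp : ‖y - p‖ ≤ r) :
    |‖O lam δ y - y‖ - ‖y - p‖| ≤ δ := by
  have h1 := hO.norm_sub_le hlam hδ h hp
  have h2 := abs_norm_sub_norm_le (O lam δ y - y) (p - y)
  rw [sub_sub_sub_cancel_right, norm_sub_rev p y] at h2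
  exact h2.trans h1

theorem IsBROO.norm_le_of_gap_le (hf : ConvexOn ℝ Set.univ f) (hO : IsBROO r f O) (hr : 0 < r)
    {lam c : ℝ} (hlam : 0 < lam) {y p : Pt d} (h : IsProx f lam y p) (hc : c ≤ 15 * r / 16)
    (hΔ : ‖O lam (r / 17) y - y‖ ≤ c) : ‖y - p‖ ≤ c + r / 17 := by
  have h1 := hO.norm_lt hf hr hlam h (hΔ.trans hc)
  have h2 := abs_le.1 (hO.abs_norm_sub_le hlam (by positivity : 0 < r / 17) h h1.le)
  linarith

theorem IsBROO.le_norm_of_le_gap (hO : IsBROO r f O) (hr : 0 < r)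
    {lam c : ℝ} (hlam : 0 < lam) {y p : Pt d} (h : IsProx f lam y p) (hc : c ≤ r)
    (hΔ : c ≤ ‖O lam (r / 17) y - y‖) : c - r / 17 ≤ ‖y - p‖ := by
  rcases le_total ‖y - p‖ r with h1 | h1
  · have h2 := abs_le.1 (hO.abs_norm_sub_le hlam (by positivity : 0 < r / 17) h h1)
    linarith
  · linarith [div_pos hr (by norm_num : (0 : ℝ) < 17)]

end Oracle

/-! ### The halving loop: termination, invariant and costs -/

section Loops

variable {Δ : ℝ → ℝ} {r m lam out : ℝ} {qs : List Query}

theorem HalvingLoop.exists (Δ : ℝ → ℝ) (r : ℝ) {m : ℝ} (hm : 0 < m) (lam : ℝ) :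
    ∃ out qs, HalvingLoop Δ r m lam out qs := by
  obtain ⟨n, hn⟩ := pow_unbounded_of_one_lt (lam / m) (one_lt_two : (1 : ℝ) < 2)
  rw [div_lt_iff₀ hm] at hn
  induction n generalizing lam with
  | zero => exact ⟨_, _, .small (by simpa using hn)⟩
  | succ n ih =>
    rcases lt_or_ge lam m with h | h
    · exact ⟨_, _, .small h⟩
    · rcases lt_or_ge (13 * r / 16) (Δ lam) with h' | h'
      · exact ⟨_, _, .far h h'⟩
      · obtain ⟨out, qs, hq⟩ := ih (lam / 2) (by rw [pow_succ] at hn; linarith)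
        exact ⟨_, _, .halve h h' hq⟩

/-- The loop invariant concerns `2 * lam`, the value before the last halving. It makes `[out, 2 *
out]` a bracket for the search and `2 * out` safe to return at the boundary. -/
theorem HalvingLoop.out_spec (h : HalvingLoop Δ r m lam out qs) (h₁ : m ≤ 2 * lam)
    (h₂ : Δ (2 * lam) ≤ 13 * r / 16) :
    m ≤ 2 * out ∧ Δ (2 * out) ≤ 13 * r / 16 ∧ (out < m ∨ 13 * r / 16 < Δ out) := by
  induction h with
  | small h => exact ⟨h₁, h₂, .inl h⟩
  | far h hΔ => exact ⟨h₁, h₂, .inr hΔ⟩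
  | halve h hΔ _ ih =>
    exact ih (by linarith) (by rwa [mul_div_cancel₀ _ two_ne_zero])

theorem HalvingLoop.le_two_mul_out (h : HalvingLoop Δ r m lam out qs) (h₁ : m ≤ 2 * lam) :
    m ≤ 2 * out := by
  induction h with
  | small h => exact h₁
  | far h hΔ => exact h₁
  | halve h hΔ _ ih => exact ih (by linarith)

theorem HalvingLoop.out_le (h : HalvingLoop Δ r m lam out qs) (hlam : 0 < lam) : out ≤ lam := by
  induction h with
  | small h => exact le_rfl
  | far h hΔ => exact le_rfl
  | halve h hΔ _ ih => linarith [ih (by linarith)]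

theorem HalvingLoop.queries (h : HalvingLoop Δ r m lam out qs) (hm : 0 < m) :
    ∀ q ∈ qs, m ≤ q.lam ∧ q.lam ≤ lam ∧ q.acc = r / 17 := by
  induction h with
  | small h => simp
  | far h hΔ => simpa using h
  | halve h hΔ _ ih =>
    intro q hq
    rcases List.mem_cons.1 hq with rfl | hq
    · exact ⟨h, le_rfl, rfl⟩
    · obtain ⟨h1, h2, h3⟩ := ih q hq
      exact ⟨h1, by linarith, h3⟩

theorem HalvingLoop.eq_nil (h : HalvingLoop Δ r m lam out qs) (hlt : lam < m) :
    out = lam ∧ qs = [] := by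
  cases h with
  | small h => exact ⟨rfl, rfl⟩
  | far h hΔ => linarith
  | halve h hΔ _ => linarith

theorem HalvingLoop.mul_two_pow_length_le (h : HalvingLoop Δ r m lam out qs)
    (h₁ : m ≤ 2 * lam) : m * 2 ^ qs.length ≤ 2 * lam := by
  induction h with
  | small h => simpa using h₁
  | far h hΔ => simpa using by linarith
  | halve h hΔ _ ih =>
    rw [List.length_cons, pow_succ]
    linarith [ih (by linarith)]

/-- A geometric series dominated by its last term. The added `3 / √lam` makes the induction close: a
halving turns it into `3√2 / √lam ≥ 4 / √lam`, which pays for one query. -/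
theorem HalvingLoop.sum_add_le (h : HalvingLoop Δ r m lam out qs) (hlam : 0 < lam) :
    (qs.map fun q => 1 / √q.lam).sum + 3 / √lam ≤ 4 / √out := by
  induction h with
  | @small lam h =>
    have := Real.sqrt_pos.2 hlam
    simp only [List.map_nil, List.sum_nil, zero_add]
    gcongr
    norm_num
  | @far lam h hΔ =>
    simp only [List.map_cons, List.map_nil, List.sum_cons, List.sum_nil, add_zero]
    rw [← add_div]
    norm_num
  | @halve lam out qs h hΔ _ ih =>
    have h1 := ih (half_pos hlam)
    have hs := Real.sqrt_pos.2 hlam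
    have h2 : 3 / √(lam / 2) = 3 * √2 / √lam := by
      rw [Real.sqrt_div hlam.le, div_div_eq_mul_div]
    have h3 : (4 : ℝ) / 3 ≤ √2 := Real.le_sqrt_of_sq_le (by norm_num)
    have h4 : 1 / √lam + 3 / √lam ≤ 3 * √2 / √lam := by
      rw [← add_div]
      gcongr
      linarith
    simp only [List.map_cons, List.sum_cons]
    linarith

end Loops

/-! ### The geometric search: termination and query count -/

section Search

variable {Δ : ℝ → ℝ} {r R Lf lamL lamU out : ℝ} {qs : List Query}

theorem le_sqrt_mul (hL : 0 < lamL) (hLU : lamL ≤ lamU) : lamL ≤ √(lamU * lamL) :=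
  Real.le_sqrt_of_sq_le (by nlinarith)

theorem sqrt_mul_le (hL : 0 < lamL) (hLU : lamL ≤ lamU) : √(lamU * lamL) ≤ lamU :=
  Real.sqrt_le_iff.2 ⟨hL.le.trans hLU, by nlinarith⟩

theorem div_sqrt_mul (hL : 0 < lamL) (hLU : lamL ≤ lamU) :
    lamU / √(lamU * lamL) = √(lamU / lamL) := by
  have hU : 0 < lamU := hL.trans_le hLU
  rw [Real.sqrt_mul hU.le, Real.sqrt_div hU.le]
  nth_rw 1 [← Real.mul_self_sqrt hU.le]
  have := (Real.sqrt_pos.2 hU).ne'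
  field_simp

theorem sqrt_mul_div (hL : 0 < lamL) (hLU : lamL ≤ lamU) :
    √(lamU * lamL) / lamL = √(lamU / lamL) := by
  have hU : 0 < lamU := hL.trans_le hLU
  rw [Real.sqrt_mul hU.le, Real.sqrt_div hU.le]
  nth_rw 2 [← Real.mul_self_sqrt hL.le]
  have := (Real.sqrt_pos.2 hL).ne'
  field_simp

theorem logb_sqrt_div (hL : 0 < lamL) (hLU : lamL ≤ lamU) :
    Real.logb 2 √(lamU / lamL) = Real.logb 2 (lamU / lamL) / 2 := by
  rw [Real.logb, Real.log_sqrt (div_nonneg (hL.le.trans hLU) hL.le), Real.logb]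
  ring

theorem SearchLoop.bounds (h : SearchLoop Δ r R Lf lamL lamU out qs) (hL : 0 < lamL)
    (hLU : lamL ≤ lamU) :
    (lamL ≤ out ∧ out ≤ lamU) ∧ ∀ q ∈ qs, lamL ≤ q.lam ∧ q.lam ≤ lamU ∧ q.acc = r / 17 := by
  induction h with
  | inside h => simpa using ⟨le_sqrt_mul hL hLU, sqrt_mul_le hL hLU⟩
  | narrow h hlog => simpa using ⟨le_sqrt_mul hL hLU, sqrt_mul_le hL hLU⟩
  | lowerU h hlog hΔ _ ih =>
    have h1 := le_sqrt_mul hL hLU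
    have h2 := sqrt_mul_le hL hLU
    obtain ⟨⟨h3, h4⟩, h5⟩ := ih hL h1
    refine ⟨⟨h3, h4.trans h2⟩, fun q hq => ?_⟩
    rcases List.mem_cons.1 hq with rfl | hq
    · exact ⟨h1, h2, rfl⟩
    · exact ⟨(h5 q hq).1, (h5 q hq).2.1.trans h2, (h5 q hq).2.2⟩
  | raiseL h hlog hΔ _ ih =>
    have h1 := le_sqrt_mul hL hLU
    have h2 := sqrt_mul_le hL hLU
    obtain ⟨⟨h3, h4⟩, h5⟩ := ih (hL.trans_le h1) h2
    refine ⟨⟨h1.trans h3, h4⟩, fun q hq => ?_⟩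
    rcases List.mem_cons.1 hq with rfl | hq
    · exact ⟨h1, h2, rfl⟩
    · exact ⟨h1.trans (h5 q hq).1, (h5 q hq).2.1, (h5 q hq).2.2⟩

theorem threshold_le {lam lam' : ℝ} (hr : 0 < r) (hR : 0 < R) (hLf : 0 < Lf) (hlam : 0 < lam)
    (hle : lam ≤ lam') : r / (8 * (R + Lf / lam)) ≤ r / (8 * (R + Lf / lam')) := by
  have : 0 < lam' := hlam.trans_le hle
  gcongr

/-- Each round halves the logarithmic width of the bracket, whereas the stopping threshold can only
rise with `lamL`; hence a fixed `b` below the initial threshold serves throughout. The `2 * b`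
covers a search that ends with its first query. -/
theorem SearchLoop.mul_two_pow_length_le (h : SearchLoop Δ r R Lf lamL lamU out qs) (hr : 0 < r)
    (hR : 0 < R) (hLf : 0 < Lf) (hL : 0 < lamL) (hLU : lamL ≤ lamU) {b : ℝ}
    (hb : b ≤ r / (8 * (R + Lf / lamL))) :
    b * 2 ^ qs.length ≤ max (4 * Real.logb 2 (lamU / lamL)) (2 * b) := by
  induction h with
  | inside h => exact le_max_of_le_right (by simp [mul_comm])
  | narrow h hlog => exact le_max_of_le_right (by simp [mul_comm])
  | lowerU h hlog hΔ _ ih =>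
    have h1 := le_sqrt_mul hL hLU
    have h2 := ih hL h1 hb
    rw [sqrt_mul_div hL hLU, logb_sqrt_div hL hLU, max_eq_left (by linarith)] at h2
    rw [List.length_cons, pow_succ]
    exact le_max_of_le_left (by linarith)
  | raiseL h hlog hΔ _ ih =>
    have h1 := le_sqrt_mul hL hLU
    have h2 := ih (hL.trans_le h1) (sqrt_mul_le hL hLU) (hb.trans (threshold_le hr hR hLf hL h1))
    rw [div_sqrt_mul hL hLU, logb_sqrt_div hL hLU, max_eq_left (by linarith)] at h2
    rw [List.length_cons, pow_succ]
    exact le_max_of_le_left (by linarith)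

theorem SearchLoop.exists (Δ : ℝ → ℝ) (hr : 0 < r) (hR : 0 < R) (hLf : 0 < Lf) (hL : 0 < lamL)
    (hLU : lamL ≤ lamU) : ∃ out qs, SearchLoop Δ r R Lf lamL lamU out qs := by
  obtain ⟨n, hn⟩ := pow_unbounded_of_one_lt
    (Real.logb 2 (lamU / lamL) / (r / (8 * (R + Lf / lamL)))) (one_lt_two : (1 : ℝ) < 2)
  rw [div_lt_iff₀ (by positivity)] at hn
  induction n generalizing lamL lamU with
  | zero =>
    by_cases h : Δ √(lamU * lamL) ∈ Set.Icc (13 * r / 16) (15 * r / 16)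
    · exact ⟨_, _, .inside h⟩
    · exact ⟨_, _, .narrow h (by simpa using hn)⟩
  | succ n ih =>
    by_cases h : Δ √(lamU * lamL) ∈ Set.Icc (13 * r / 16) (15 * r / 16)
    · exact ⟨_, _, .inside h⟩
    rcases lt_or_ge (Real.logb 2 (lamU / lamL)) (r / (8 * (R + Lf / lamL))) with h1 | h1
    · exact ⟨_, _, .narrow h h1⟩
    have h2 := le_sqrt_mul hL hLU
    rw [pow_succ] at hn
    by_cases h' : Δ √(lamU * lamL) < 13 * r / 16
    · obtain ⟨out, qs, hq⟩ := ih hL h2 (by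
        rw [sqrt_mul_div hL hLU, logb_sqrt_div hL hLU]; linarith)
      exact ⟨_, _, .lowerU h h1 h' hq⟩
    · obtain ⟨out, qs, hq⟩ := ih (hL.trans_le h2) (sqrt_mul_le hL hLU) (by
        rw [div_sqrt_mul hL hLU, logb_sqrt_div hL hLU]
        have := mul_le_mul_of_nonneg_left (threshold_le hr hR hLf hL h2)
          (by positivity : (0 : ℝ) ≤ 2 ^ n)
        linarith)
      exact ⟨_, _, .raiseL h h1 h' hq⟩

end Search

/-! ### Query count and weighted cost of one bisection -/

section BisectionBounds

variable {Δ : ℝ → ℝ} {r R Lf ε out : ℝ} {qs : List Query}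

theorem Bisection.exists (Δ : ℝ → ℝ) (hr : 0 < r) (hR : 0 < R) (hLf : 0 < Lf) (lamMax : ℝ)
    {lamMin : ℝ} (hm : 0 < lamMin) : ∃ out qs, Bisection Δ r R Lf lamMax lamMin out qs := by
  obtain ⟨lam, qs, h⟩ := HalvingLoop.exists Δ r hm lamMax
  by_cases h1 : lam ≤ lamMin
  · exact ⟨_, _, .boundary h h1⟩
  by_cases h2 : Δ lam ≤ 15 * r / 16
  · exact ⟨_, _, .early h h1 h2⟩
  have hlam : 0 < lam := hm.trans (not_le.1 h1)
  obtain ⟨out, qs', h'⟩ := SearchLoop.exists Δ hr hR hLf hlam (by linarith : lam ≤ 2 * lam)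
  exact ⟨_, _, .search h h1 h2 h'⟩

theorem Bisection.of_lt {lamMax lamMin : ℝ} (h : Bisection Δ r R Lf lamMax lamMin out qs)
    (hlt : lamMax < lamMin) : out = 2 * lamMax ∧ qs = [] := by
  cases h with
  | boundary h₁ h => rw [(h₁.eq_nil hlt).1, (h₁.eq_nil hlt).2]; simp
  | early h₁ h => exact absurd ((h₁.eq_nil hlt).1 ▸ hlt.le) h
  | search h₁ h => exact absurd ((h₁.eq_nil hlt).1 ▸ hlt.le) h

theorem Bisection.bounds {lamMax lamMin : ℝ} (h : Bisection Δ r R Lf lamMax lamMin out qs)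
    (hm : 0 < lamMin) (hle : lamMin ≤ lamMax) :
    (lamMin ≤ out ∧ out ≤ 2 * lamMax) ∧
      ∀ q ∈ qs, lamMin ≤ q.lam ∧ q.lam ≤ 2 * lamMax ∧ q.acc = r / 17 := by
  have hM : 0 < lamMax := hm.trans_le hle
  cases h with
  | boundary h₁ h =>
    refine ⟨⟨h₁.le_two_mul_out (by linarith), by linarith [h₁.out_le hM]⟩, fun q hq => ?_⟩
    obtain ⟨h2, h3, h4⟩ := h₁.queries hm q hq
    exact ⟨h2, by linarith, h4⟩
  | early h₁ h =>
    refine ⟨⟨(not_le.1 h).le, by linarith [h₁.out_le hM]⟩, fun q hq => ?_⟩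
    obtain ⟨h2, h3, h4⟩ := h₁.queries hm q hq
    exact ⟨h2, by linarith, h4⟩
  | search h₁ h hΔ h₂ =>
    have h' := not_le.1 h
    obtain ⟨⟨h3, h4⟩, h5⟩ := h₂.bounds (hm.trans h') (by linarith)
    have h6 := h₁.out_le hM
    refine ⟨⟨by linarith, by linarith⟩, fun q hq => ?_⟩
    rcases List.mem_append.1 hq with hq | hq
    · obtain ⟨h2, h3, h4⟩ := h₁.queries hm q hq
      exact ⟨h2, by linarith, h4⟩
    · obtain ⟨h7, h8, h9⟩ := h5 q hq
      exact ⟨by linarith, by linarith, h9⟩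

/-- Take logarithms; the factor 2 comes from `log 2 > 1/2`. -/
theorem natCast_le_of_two_pow_le {n : ℕ} {K w : ℝ} (k : ℕ) (hK : K ≤ 2 ^ k) (hw : 0 < w)
    (h : 2 ^ n ≤ K * w) : (n : ℝ) ≤ k + 2 * Real.posLog w := by
  have h1 : (2 : ℝ) ^ n ≤ 2 ^ k * w := h.trans (by gcongr)
  have h2 := Real.log_le_log (by positivity) h1
  rw [Real.log_mul (by positivity) hw.ne', Real.log_pow, Real.log_pow] at h2
  have h3 : Real.log w ≤ Real.posLog w := le_max_right _ _
  have h4 : 0 ≤ Real.posLog w := Real.posLog_nonneg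
  have h5 := Real.log_two_gt_d9
  by_contra! h6
  nlinarith

theorem HalvingLoop.length_le {lam : ℝ}
    (h : HalvingLoop Δ r (ε / (6 * r * R)) (2 * Lf / r) lam qs) (hr : 0 < r) (hrR : r ≤ R)
    (hLf : 0 < Lf) (hε : 0 < ε) (hle : ε / (6 * r * R) ≤ 2 * Lf / r) :
    (qs.length : ℝ) ≤ 5 + 2 * Real.posLog (Lf * R ^ 2 / (ε * r)) := by
  have hR : 0 < R := hr.trans_le hrR
  have h1 := h.mul_two_pow_length_le (by linarith [show 0 < 2 * Lf / r by positivity])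
  refine natCast_le_of_two_pow_le (K := 24) 5 (by norm_num) (by positivity) ?_
  have h2 : (2 : ℝ) ^ qs.length ≤ 24 * (Lf * R / ε) := by
    rw [div_mul_eq_mul_div, div_le_iff₀ (by positivity)] at h1
    refine le_of_mul_le_mul_left (h1.trans_eq ?_) hε
    field_simp
    ring
  refine h2.trans ?_
  gcongr 24 * ?_
  rw [div_le_div_iff₀ hε (by positivity)]
  have : 0 < Lf * R * ε := by positivity
  nlinarith

theorem SearchLoop.length_le {lam : ℝ} (h : SearchLoop Δ r R Lf lam (2 * lam) out qs)
    (hr : 0 < r) (hrR : r ≤ R) (hLf : 0 < Lf) (hε : 0 < ε) (hlam : ε / (6 * r * R) ≤ lam)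
    (hle : ε / (6 * r * R) ≤ 2 * Lf / r) :
    (qs.length : ℝ) ≤ 10 + 2 * Real.posLog (Lf * R ^ 2 / (ε * r)) := by
  have hR : 0 < R := hr.trans_le hrR
  have hm : 0 < ε / (6 * r * R) := by positivity
  have hl : 0 < lam := hm.trans_le hlam
  have h1 := h.mul_two_pow_length_le hr hR hLf hl (by linarith) le_rfl
  -- With `w = Lf R² / (ε r)`, the count satisfies `2 ^ n ≤ 32 (R / r + Lf / (lam r))`; the two
  -- summands are at most `12 w` and `6 w`, and `32 * 18 = 576`.
  refine natCast_le_of_two_pow_le (K := 576) 10 (by norm_num) (by positivity) ?_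
  rw [mul_div_cancel_right₀ _ hl.ne', Real.logb_self_eq_one one_lt_two] at h1
  have h2 : 1 / 12 * (R / r) ≤ Lf * R ^ 2 / (ε * r) := by
    rw [div_le_div_iff₀ (by positivity) hr] at hle
    rw [mul_div_assoc', div_le_div_iff₀ hr (by positivity)]
    have : ε * r ≤ 12 * (Lf * R) * r := by linarith
    nlinarith
  have h3 : Lf / lam / r ≤ 6 * (Lf * R ^ 2 / (ε * r)) := by
    have : Lf / lam ≤ Lf / (ε / (6 * r * R)) := by gcongr
    have e : Lf / (ε / (6 * r * R)) = 6 * (Lf * R * r / ε) := by field_simp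
    have h4 : Lf * R * r / ε / r ≤ Lf * R ^ 2 / (ε * r) := by
      rw [div_div]
      refine div_le_div_of_nonneg_right ?_ (by positivity)
      nlinarith [mul_pos hLf hR]
    calc Lf / lam / r ≤ 6 * (Lf * R * r / ε) / r := by gcongr; linarith
      _ = 6 * (Lf * R * r / ε / r) := by ring
      _ ≤ _ := by gcongr
  set b := r / (8 * (R + Lf / lam)) with hb
  have hbpos : 0 < b := by positivity
  have hb8 : b ≤ 1 / 8 := by
    rw [hb, div_le_div_iff₀ (by positivity) (by norm_num)]
    have : 0 < Lf / lam := by positivity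
    nlinarith
  rw [max_eq_left (by linarith)] at h1
  have h4 : 1 / b = 8 * (R / r + Lf / lam / r) := by
    rw [hb]
    field_simp
  have h5 : (2 : ℝ) ^ qs.length ≤ 4 * (1 / b) := by
    rw [mul_one_div, le_div_iff₀ hbpos]
    linarith
  rw [h4] at h5
  linarith

theorem sum_le_length_mul {lam : ℝ} (hlam : 0 < lam) {qs : List Query}
    (h : ∀ q ∈ qs, lam ≤ q.lam) :
    (qs.map fun q => 1 / √q.lam).sum ≤ qs.length * (1 / √lam) := by
  have h1 : ∀ x ∈ qs.map (fun q => 1 / √q.lam), x ≤ 1 / √lam := by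
    intro x hx
    obtain ⟨q, hq, rfl⟩ := List.mem_map.1 hx
    have := Real.sqrt_pos.2 hlam
    have := Real.sqrt_le_sqrt (h q hq)
    gcongr
  simpa using List.sum_le_card_nsmul _ _ h1

theorem Bisection.length_le
    (h : Bisection Δ r R Lf (2 * Lf / r) (ε / (6 * r * R)) out qs) (hr : 0 < r) (hrR : r ≤ R)
    (hLf : 0 < Lf) (hε : 0 < ε) (hle : ε / (6 * r * R) ≤ 2 * Lf / r) :
    (qs.length : ℝ) ≤ 15 * (1 + Real.posLog (Lf * R ^ 2 / (ε * r))) := by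
  have hp : 0 ≤ Real.posLog (Lf * R ^ 2 / (ε * r)) := Real.posLog_nonneg
  cases h with
  | boundary h₁ h => linarith [h₁.length_le hr hrR hLf hε hle]
  | early h₁ h => linarith [h₁.length_le hr hrR hLf hε hle]
  | search h₁ h hΔ h₂ =>
    rw [List.length_append, Nat.cast_add]
    linarith [h₁.length_le hr hrR hLf hε hle, h₂.length_le hr hrR hLf hε (not_le.1 h).le hle]

theorem one_div_sqrt_le {lam : ℝ} (hlam : 0 < lam) (hout : 0 < out) (h : out ≤ 2 * lam) :
    1 / √lam ≤ 3 / 2 * (1 / √out) := by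
  have h1 : √out ≤ 3 / 2 * √lam := by
    rw [Real.sqrt_le_left (by positivity), mul_pow, Real.sq_sqrt hlam.le]
    linarith
  have := Real.sqrt_pos.2 hlam
  have := Real.sqrt_pos.2 hout
  rw [mul_one_div, div_le_div_iff₀ (by positivity) (by positivity)]
  linarith

/-- Halving queries form a geometric series, and search queries all lie above the lower end of a
bracket of ratio 2 that contains `out`. Only the latter pay the logarithm. -/
theorem Bisection.sum_le
    (h : Bisection Δ r R Lf (2 * Lf / r) (ε / (6 * r * R)) out qs) (hr : 0 < r) (hrR : r ≤ R)
    (hLf : 0 < Lf) (hε : 0 < ε) (hle : ε / (6 * r * R) ≤ 2 * Lf / r) :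
    (qs.map fun q => 1 / √q.lam).sum
      ≤ 21 * (1 + Real.posLog (Lf * R ^ 2 / (ε * r))) * (1 / √out) := by
  have hR : 0 < R := hr.trans_le hrR
  have hp : 0 ≤ Real.posLog (Lf * R ^ 2 / (ε * r)) := Real.posLog_nonneg
  have hm : 0 < ε / (6 * r * R) := by positivity
  have hM : 0 < 2 * Lf / r := by positivity
  have hout : 0 < out := hm.trans_le (h.bounds hm hle).1.1
  have hs : 0 < 1 / √out := by have := Real.sqrt_pos.2 hout; positivity
  have key : ∀ {lam : ℝ} {qs : List Query},
      HalvingLoop Δ r (ε / (6 * r * R)) (2 * Lf / r) lam qs → out ≤ 2 * lam →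
      (qs.map fun q => 1 / √q.lam).sum ≤ 6 * (1 / √out) := by
    intro lam qs h1 h2
    have h3 := h1.sum_add_le hM
    have h4 := one_div_sqrt_le (by linarith) hout h2
    have h5 : 0 ≤ 3 / √(2 * Lf / r) := by positivity
    have h6 : 4 / √lam = 4 * (1 / √lam) := by ring
    linarith
  have hmul : 0 ≤ Real.posLog (Lf * R ^ 2 / (ε * r)) * (1 / √out) := by positivity
  cases h with
  | boundary h₁ h => nlinarith [key h₁ le_rfl]
  | early h₁ h => nlinarith [key h₁ (by linarith)]
  | search h₁ h hΔ h₂ =>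
    have hlam := hm.trans (not_le.1 h)
    obtain ⟨⟨h3, h4⟩, h5⟩ := h₂.bounds hlam (by linarith)
    have h6 := key h₁ h4
    have h7 := sum_le_length_mul hlam fun q hq => (h5 q hq).1
    have h8 := h₂.length_le hr hrR hLf hε (not_le.1 h).le hle
    have h9 := one_div_sqrt_le hlam hout h4
    have h10 := mul_le_mul h8 h9 (by positivity) (by positivity)
    rw [List.map_append, List.sum_append]
    nlinarith

end BisectionBounds

/-! ### Dependence of the query point on the parameter -/

section Alpha

theorem alpha_eq {τ : ℝ} (hτ : 0 ≤ τ) : alpha τ = 1 - 2 / (√(1 + 2 * τ) + 1) := by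
  have hs := Real.sq_sqrt (by linarith : 0 ≤ 1 + 2 * τ)
  have hs0 := Real.sqrt_nonneg (1 + 2 * τ)
  rw [alpha]
  generalize √(1 + 2 * τ) = s at hs hs0 ⊢
  obtain rfl : τ = (s ^ 2 - 1) / 2 := by linarith
  have h1 : s + 1 ≠ 0 := by positivity
  have h2 : 1 + (s ^ 2 - 1) / 2 + s = (s + 1) ^ 2 / 2 := by ring
  rw [h2]
  field_simp
  ring

theorem alpha_le_one {τ : ℝ} (hτ : 0 ≤ τ) : alpha τ ≤ 1 := by
  rw [alpha_eq hτ]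
  have : 0 ≤ 2 / (√(1 + 2 * τ) + 1) := by positivity
  linarith

theorem alpha_mono {τ τ' : ℝ} (hτ : 0 ≤ τ) (h : τ ≤ τ') : alpha τ ≤ alpha τ' := by
  rw [alpha_eq hτ, alpha_eq (hτ.trans h)]
  gcongr

theorem div_mul_alpha_le {A lam lam' : ℝ} (hA : 0 ≤ A) (hlam : 0 < lam) (h : lam ≤ lam') :
    lam / lam' * alpha (2 * A * lam') ≤ alpha (2 * A * lam) := by
  have hlam' : 0 < lam' := hlam.trans_le h
  have h1 : lam / lam' * alpha (2 * A * lam')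
      = 2 * A * lam / (1 + 2 * A * lam' + √(1 + 2 * (2 * A * lam'))) := by
    rw [alpha, div_mul_div_comm, div_eq_div_iff (by positivity) (by positivity)]
    ring
  rw [h1, alpha]
  gcongr

/-- The weight increases with `lam` but less than proportionally, and it is at most 1. -/
theorem abs_alpha_sub_le {A lam lam' : ℝ} (hA : 0 ≤ A) (hlam : 0 < lam) (h : lam ≤ lam') :
    |alpha (2 * A * lam) - alpha (2 * A * lam')| ≤ 1 - lam / lam' := by
  have hlam' : 0 < lam' := hlam.trans_le h
  have h1 := div_mul_alpha_le hA hlam h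
  have h2 := alpha_mono (by positivity : 0 ≤ 2 * A * lam)
    (by gcongr : 2 * A * lam ≤ 2 * A * lam')
  have h3 := alpha_le_one (by positivity : 0 ≤ 2 * A * lam')
  have h4 : lam / lam' ≤ 1 := (div_le_one hlam').2 h
  rw [abs_of_nonpos (by linarith)]
  nlinarith

theorem norm_bisectPoint_sub_le {d : ℕ} (x v : Pt d) {A lam lam' : ℝ} (hA : 0 ≤ A)
    (hlam : 0 < lam) (h : lam ≤ lam') :
    ‖bisectPoint x v A lam - bisectPoint x v A lam'‖ ≤ (1 - lam / lam') * ‖x - v‖ := by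
  rw [show bisectPoint x v A lam - bisectPoint x v A lam'
    = (alpha (2 * A * lam) - alpha (2 * A * lam')) • (x - v) by
      simp only [bisectPoint]; module, norm_smul, Real.norm_eq_abs]
  gcongr
  exact abs_alpha_sub_le hA hlam h

end Alpha

/-! ### Correctness of the bisection -/

section BisectionSpec

variable {d : ℕ} {f : Pt d → ℝ} {Lf : ℝ≥0} {r R : ℝ} {O : ℝ → ℝ → Pt d → Pt d} {x v : Pt d}
  {A : ℝ}

theorem norm_bisectPoint_sub_prox_le (hf : ConvexOn ℝ Set.univ f) (hL : LipschitzWith Lf f)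
    (hxv : ‖x - v‖ ≤ 2 * R) (hA : 0 ≤ A) {lam lam' : ℝ} (hlam : 0 < lam) (hle : lam ≤ lam')
    {p p' : Pt d} (h : IsProx f lam (bisectPoint x v A lam) p)
    (h' : IsProx f lam' (bisectPoint x v A lam') p') :
    ‖bisectPoint x v A lam - p‖
      ≤ ‖bisectPoint x v A lam' - p'‖ + (1 - lam / lam') * (2 * R + Lf / lam) := by
  have h1 := h.norm_le_add hf hL hlam hle h'
  have h2 := norm_bisectPoint_sub_le x v hA hlam hle
  have h3 : 0 ≤ 1 - lam / lam' := by
    have := (div_le_one (hlam.trans_le hle)).2 hle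
    linarith
  have h4 := mul_le_mul_of_nonneg_left hxv h3
  linarith

/-- Bounds the drift of the displacement over half of a final bracket. By `log 2 ≤ 7/10`, it is at
most `(7/10) * r / (16 (R + Lf / b)) * 2 (R + Lf / b)`. -/
theorem one_sub_div_mul_le {Lf lam lam' : ℝ} (hr : 0 < r) (hR : 0 < R) (hLf : 0 < Lf)
    (hlam : 0 < lam) (hlam' : 0 < lam') {b : ℝ} (hb : 0 < b) (hbl : b ≤ lam)
    (hlog : Real.logb 2 (lam' / lam) ≤ r / (8 * (R + Lf / b)) / 2) :
    (1 - lam / lam') * (2 * R + Lf / lam) ≤ 7 * r / 80 := by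
  have h1 : 1 - lam / lam' ≤ Real.log (lam' / lam) := by
    have := Real.one_sub_inv_le_log_of_pos (by positivity : 0 < lam' / lam)
    rwa [inv_div] at this
  have h2 : Real.log (lam' / lam) = Real.log 2 * Real.logb 2 (lam' / lam) := by
    rw [Real.logb]
    have := (Real.log_pos one_lt_two).ne'
    field_simp
  have h3 := Real.log_two_lt_d9
  have h4 := Real.log_pos one_lt_two
  have h5 : Lf / lam ≤ Lf / b := by gcongr
  have h6 : 0 < Lf / lam := by positivity
  have h7 : 1 - lam / lam' ≤ 7 / 10 * (r / (8 * (R + Lf / b)) / 2) := by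
    rw [h2] at h1
    have h8 : 0 < r / (8 * (R + Lf / b)) / 2 := by positivity
    have h9 := mul_le_mul_of_nonneg_left hlog h4.le
    nlinarith
  calc (1 - lam / lam') * (2 * R + Lf / lam)
      ≤ 7 / 10 * (r / (8 * (R + Lf / b)) / 2) * (2 * R + Lf / lam) := by gcongr
    _ ≤ 7 / 10 * (r / (8 * (R + Lf / b)) / 2) * (2 * (R + Lf / b)) := by gcongr; linarith
    _ = 7 * r / 80 := by field_simp; norm_num

theorem SearchLoop.norm_mem (hf : ConvexOn ℝ Set.univ f) (hL : LipschitzWith Lf f)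
    (hLf : 0 < Lf) (hO : IsBROO r f O) (hr : 0 < r) (hR : 0 < R)
    (hxv : ‖x - v‖ ≤ 2 * R) (hA : 0 ≤ A) {lamL lamU out : ℝ} {qs : List Query}
    (h : SearchLoop (bisectGap O r x v A) r R Lf lamL lamU out qs) (h0 : 0 < lamL)
    (hLU : lamL ≤ lamU) (hU : bisectGap O r x v A lamU ≤ 13 * r / 16)
    (hl : 15 * r / 16 < bisectGap O r x v A lamL) {p : Pt d}
    (hp : IsProx f out (bisectPoint x v A out) p) :
    3 * r / 4 ≤ ‖bisectPoint x v A out - p‖ ∧ ‖bisectPoint x v A out - p‖ < r := by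
  induction h with
  | inside h =>
    have hm : 0 < √(_ * _) := h0.trans_le (le_sqrt_mul h0 hLU)
    have h1 := hO.norm_lt hf hr hm hp h.2
    have h2 := hO.le_norm_of_le_gap hr hm hp (by linarith) h.1
    exact ⟨by linarith, h1⟩
  | @narrow lamL lamU h hlog =>
    have h1 := le_sqrt_mul h0 hLU
    have h2 := sqrt_mul_le h0 hLU
    have hm := h0.trans_le h1
    have hU0 := h0.trans_le hLU
    have hLf' : (0 : ℝ) < Lf := hLf
    obtain ⟨pl, hpl⟩ := exists_isProx hf hL h0 (bisectPoint x v A lamL)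
    obtain ⟨pu, hpu⟩ := exists_isProx hf hL hU0 (bisectPoint x v A lamU)
    have h3 := hO.norm_le_of_gap_le hf hr hU0 hpu (by linarith) hU
    have h4 := hO.le_norm_of_le_gap hr h0 hpl (by linarith) hl.le
    have h5 := norm_bisectPoint_sub_prox_le hf hL hxv hA h0 h1 hpl hp
    have h6 := norm_bisectPoint_sub_prox_le hf hL hxv hA hm h2 hp hpu
    have h7 := one_sub_div_mul_le (Lf := Lf) hr hR hLf' h0 hm h0 le_rfl (by
      rw [sqrt_mul_div h0 hLU, logb_sqrt_div h0 hLU]; linarith)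
    have h8 := one_sub_div_mul_le (Lf := Lf) hr hR hLf' hm hU0 h0 h1 (by
      rw [div_sqrt_mul h0 hLU, logb_sqrt_div h0 hLU]; linarith)
    -- Upper bound from the right end: `13/16 + 1/17 + 7/80 < 1`. Lower bound from the left end:
    -- `15/16 - 1/17 - 7/80 ≥ 3/4`.
    constructor <;> linarith
  | lowerU h hlog hΔ _ ih => exact ih h0 (le_sqrt_mul h0 hLU) hΔ.le hl hp
  | raiseL h hlog hΔ _ ih =>
    refine ih (h0.trans_le (le_sqrt_mul h0 hLU)) (sqrt_mul_le h0 hLU) hU ?_ hp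
    by_contra! h'
    exact h ⟨not_lt.1 hΔ, h'⟩

theorem bisectGap_le_of_two_mul_div_le (hL : LipschitzWith Lf f)
    (hf : ConvexOn ℝ Set.univ f) (hLf : 0 < Lf) (hO : IsBROO r f O) (hr : 0 < r)
    {lam : ℝ} (h : 2 * Lf / r ≤ lam) : bisectGap O r x v A lam ≤ 13 * r / 16 := by
  have hlam : 0 < lam := lt_of_lt_of_le (by positivity) h
  obtain ⟨p, hp⟩ := exists_isProx hf hL hlam (bisectPoint x v A lam)
  have h1 := hp.mul_norm_le hL
  have h2 : ‖bisectPoint x v A lam - p‖ ≤ r / 2 := by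
    rw [div_le_iff₀ hr] at h
    have := norm_nonneg (bisectPoint x v A lam - p)
    refine le_of_mul_le_mul_left ?_ hlam
    linarith
  have h3 := abs_le.1 (hO.abs_norm_sub_le hlam (by positivity : 0 < r / 17) hp (by linarith))
  rw [bisectGap]
  linarith

theorem Bisection.norm_spec (hf : ConvexOn ℝ Set.univ f) (hL : LipschitzWith Lf f)
    (hLf : 0 < Lf) (hO : IsBROO r f O) (hr : 0 < r) (hR : 0 < R)
    (hxv : ‖x - v‖ ≤ 2 * R) (hA : 0 ≤ A) {lamMin out : ℝ} {qs : List Query} (hm : 0 < lamMin)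
    (hle : lamMin ≤ 2 * Lf / r)
    (h : Bisection (bisectGap O r x v A) r R Lf (2 * Lf / r) lamMin out qs) {p : Pt d}
    (hp : IsProx f out (bisectPoint x v A out) p) :
    ‖bisectPoint x v A out - p‖ < r ∧
      (2 * lamMin < out → 3 * r / 4 ≤ ‖bisectPoint x v A out - p‖) := by
  have hM : 0 < 2 * Lf / r := by positivity
  have hout : 0 < out := hm.trans_le (h.bounds hm hle).1.1
  have key : ∀ {lam : ℝ} {qs : List Query},
      HalvingLoop (bisectGap O r x v A) r lamMin (2 * Lf / r) lam qs →
      bisectGap O r x v A (2 * lam) ≤ 13 * r / 16 ∧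
        (lam < lamMin ∨ 13 * r / 16 < bisectGap O r x v A lam) := by
    -- The invariant holds on entry because `2 * lamMax` also exceeds `2 Lf / r`; thus `2 * lam` is
    -- a valid upper end even if no halving took place.
    intro lam qs h1
    exact (h1.out_spec (by linarith)
      (bisectGap_le_of_two_mul_div_le hL hf hLf hO hr (by linarith))).2
  cases h with
  | boundary h₁ h =>
    exact ⟨hO.norm_lt hf hr hout hp ((key h₁).1.trans (by linarith)), fun h' => by linarith⟩
  | early h₁ h hΔ =>
    refine ⟨hO.norm_lt hf hr hout hp hΔ, fun _ => ?_⟩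
    have h1 := ((key h₁).2.resolve_left fun h' => h h'.le).le
    have h2 := hO.le_norm_of_le_gap hr hout hp (by linarith) h1
    linarith
  | search h₁ h hΔ h₂ =>
    have hlam := hm.trans (not_le.1 h)
    have h1 := h₂.norm_mem hf hL hLf hO hr hR hxv hA hlam (by linarith) (key h₁).1
      (not_le.1 hΔ) hp
    exact ⟨h1.2, fun _ => h1.1⟩

end BisectionSpec

/-! ### One accelerated step with an inexact proximal point -/

section MirrorStep

variable {E : Type*} [NormedAddCommGroup E] [InnerProductSpace ℝ E]

/-- First-order optimality of a projected (mirror descent) step. -/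
theorem inner_nonneg_of_isMinOn {s : Set E} (hs : Convex ℝ s) {c : ℝ} {g v w u : E}
    (hw : w ∈ s) (hu : u ∈ s)
    (h : IsMinOn (fun z => c * inner ℝ g z + 1 / 2 * ‖z - v‖ ^ 2) s w) :
    0 ≤ c * inner ℝ g (u - w) + inner ℝ (w - v) (u - w) := by
  refine nonneg_of_forall_add_mul_nonneg (K := 1 / 2 * ‖u - w‖ ^ 2) fun t ht0 ht1 => ?_
  have h1 : c * inner ℝ g w + 1 / 2 * ‖w - v‖ ^ 2 ≤
      c * inner ℝ g (w + t • (u - w)) + 1 / 2 * ‖w + t • (u - w) - v‖ ^ 2 :=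
    h (hs.add_smul_sub_mem hw hu ⟨ht0.le, ht1⟩)
  rw [show w + t • (u - w) - v = (w - v) + t • (u - w) by abel, norm_add_sq_real, inner_add_right,
    inner_smul_right, inner_smul_right, norm_smul, mul_pow, Real.norm_eq_abs, sq_abs] at h1
  refine nonneg_of_mul_nonneg_right ?_ ht0
  linarith

theorem inner_sub_sub_eq (v w u : E) :
    inner ℝ (w - v) (u - w) = 1 / 2 * ‖v - u‖ ^ 2 - 1 / 2 * ‖w - u‖ ^ 2 - 1 / 2 * ‖w - v‖ ^ 2 := by
  rw [show v - u = (w - u) - (w - v) by abel, show u - w = -(w - u) by abel, inner_neg_right,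
    norm_sub_sq_real, real_inner_comm]
  ring

/-- One step of the accelerated proximal point method with an inexact proximal point `x'`. -/
theorem IsProx.potential_step {f : E → ℝ} {lam a A A' δ : ℝ} {x v y p x' v' u : E}
    (hp : IsProx f lam y p) (hA : 0 ≤ A) (ha : 0 ≤ a) (hA' : A' = A + a)
    (hsq : lam * a ^ 2 = A') (hy : A' • y = A • x + a • v)
    (happrox : f x' + lam / 2 * ‖x' - y‖ ^ 2 ≤ f p + lam / 2 * ‖p - y‖ ^ 2 + lam / 2 * δ ^ 2)
    (hv : 0 ≤ a * lam * inner ℝ (y - x') (u - v') + inner ℝ (v' - v) (u - v')) :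
    A' * (f x' - f u) + 1 / 2 * ‖v' - u‖ ^ 2 + 1 / 2 * lam * A' * (‖y - p‖ ^ 2 - δ ^ 2)
      ≤ A * (f x - f u) + 1 / 2 * ‖v - u‖ ^ 2 + a * lam * inner ℝ (x' - p) (v - u) := by
  have h1 := mul_le_mul_of_nonneg_left (hp x) hA
  have h2 := mul_le_mul_of_nonneg_left (hp u) ha
  have hA'0 : 0 ≤ A' := by rw [hA']; positivity
  have h3 := mul_le_mul_of_nonneg_left happrox hA'0
  have h4 : A * inner ℝ (y - p) (x - p) + a * inner ℝ (y - p) (u - p)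
      = A' * ‖y - p‖ ^ 2 - a * inner ℝ (y - p) (v - u) := by
    -- The coupling `A' y = A x + a v` combines the subgradient inequalities at `x` and `u` into a
    -- multiple of `‖y - p‖²` and a term in `v - u`.
    have e : A • (x - p) + a • (u - p) = A' • (y - p) - a • (v - u) := by
      rw [smul_sub A', hy, hA']
      module
    have := congrArg (inner ℝ (y - p)) e
    simpa only [inner_add_right, inner_sub_right (y - p) (A' • (y - p)), inner_smul_right,
      real_inner_self_eq_norm_sq] using this
  rw [inner_sub_sub_eq] at hv
  have h5 : ‖x' - y‖ ^ 2 = ‖(y - p) - (x' - p)‖ ^ 2 := by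
    rw [sub_sub_sub_cancel_right, norm_sub_rev]
  -- The loss of the mirror step, `(a lam)² ‖y - x'‖² / 2`, equals `A'` times the quadratic term in
  -- the oracle inequality, because `(a lam)² = lam A'`; the two cancel.
  have h6 : (0 : ℝ) ≤ ‖(v' - v) + (a * lam) • (y - x')‖ ^ 2 := by positivity
  rw [norm_add_sq_real, inner_smul_right, norm_smul, mul_pow, Real.norm_eq_abs, sq_abs,
    norm_sub_rev y x', real_inner_comm] at h6
  have h7 : inner ℝ (y - x') (u - v') = -inner ℝ (y - x') (v - u) - inner ℝ (y - x') (v' - v) := by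
    rw [← inner_neg_right, ← inner_sub_right]
    congr 1
    abel
  have h8 : inner ℝ (y - x') (v - u) = inner ℝ (y - p) (v - u) - inner ℝ (x' - p) (v - u) := by
    rw [← inner_sub_left]
    congr 1
    abel
  have h9 : (a * lam) ^ 2 = lam * A' := by rw [← hsq]; ring
  rw [h9] at h6
  rw [h7, h8] at hv
  rw [norm_sub_rev p y] at h3
  have h10 := congrArg (lam * ·) h4
  subst hA'
  linarith

theorem add_mul_norm_sq_le {f : E → ℝ} {lam δ : ℝ} {y p x' u : E} (hp : IsProx f lam y p)
    (happrox : f x' + lam / 2 * ‖x' - y‖ ^ 2 ≤ f p + lam / 2 * ‖p - y‖ ^ 2 + lam / 2 * δ ^ 2)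
    (hlam : 0 ≤ lam) :
    f x' - f u + lam / 2 * ‖p - u‖ ^ 2 ≤ lam / 2 * ‖y - u‖ ^ 2 + lam / 2 * δ ^ 2 := by
  have h1 := hp.quadratic_growth u
  rw [norm_sub_rev u p, norm_sub_rev u y] at h1
  have : 0 ≤ lam / 2 * ‖x' - y‖ ^ 2 := by positivity
  linarith

end MirrorStep

/-! ### The step size equation -/

section Coefficients

variable {lam A a : ℝ}

theorem coeff_pos (hlam : 0 < lam) (ha : a = 1 / (2 * lam) * (1 + √(1 + 4 * lam * A))) :
    0 < a := by
  rw [ha]; positivity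

theorem coeff_sq (hlam : 0 < lam) (hA : 0 ≤ A)
    (ha : a = 1 / (2 * lam) * (1 + √(1 + 4 * lam * A))) : lam * a ^ 2 = A + a := by
  have h := Real.sq_sqrt (by positivity : 0 ≤ 1 + 4 * lam * A)
  rw [ha]
  generalize √(1 + 4 * lam * A) = s at h ⊢
  field_simp
  linear_combination h

/-- Identifies the point probed by the bisection with the main-loop point `y t`. -/
theorem alpha_coeff (hlam : 0 < lam) (hA : 0 ≤ A)
    (ha : a = 1 / (2 * lam) * (1 + √(1 + 4 * lam * A))) : alpha (2 * A * lam) = A / (A + a) := by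
  have ha0 := coeff_pos hlam ha
  have h1 : √(1 + 2 * (2 * A * lam)) + 1 = 2 * lam * a := by
    rw [ha, show 1 + 2 * (2 * A * lam) = 1 + 4 * lam * A by ring]
    field_simp
    ring
  have h2 : A / (A + a) = 1 - a / (A + a) := by
    rw [eq_sub_iff_add_eq, ← add_div, div_self (by positivity)]
  rw [alpha_eq (by positivity), h1, h2, ← coeff_sq hlam hA ha]
  field_simp

end Coefficients

/-- The standing assumptions, in the regime where the range of the bisection is nonempty. -/
structure Problem {d : ℕ} (f : Pt d → ℝ) (O : ℝ → ℝ → Pt d → Pt d) (Lf : ℝ≥0) (R r ε : ℝ) :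
    Prop where
  convex : ConvexOn ℝ Set.univ f
  lipschitz : LipschitzWith Lf f
  Lf_pos : 0 < Lf
  r_pos : 0 < r
  r_le : r ≤ R
  eps_pos : 0 < ε
  broo : IsBROO r f O
  range_le : ε / (6 * r * R) ≤ 2 * Lf / r

/-! ### One iteration of the main loop -/

section Step

variable {d : ℕ} {f : Pt d → ℝ} {Lf : ℝ≥0} {r R ε : ℝ} {O : ℝ → ℝ → Pt d → Pt d} {x₀ : Pt d}
  {τ : Trace d} {t : ℕ}

theorem Problem.R_pos (P : Problem f O Lf R r ε) : 0 < R := P.r_pos.trans_le P.r_le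

theorem Problem.lamMin_pos (P : Problem f O Lf R r ε) : 0 < ε / (6 * r * R) := by
  have := P.R_pos
  have := P.r_pos
  have := P.eps_pos
  positivity

theorem Trace.IsStep.le_lam (h : τ.IsStep O Lf R r ε x₀ t) (P : Problem f O Lf R r ε) :
    ε / (6 * r * R) ≤ τ.lam (t + 1) :=
  (h.lam_eq.bounds P.lamMin_pos P.range_le).1.1

theorem Trace.IsStep.lam_pos (h : τ.IsStep O Lf R r ε x₀ t) (P : Problem f O Lf R r ε) :
    0 < τ.lam (t + 1) :=
  P.lamMin_pos.trans_le (h.le_lam P)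

theorem Trace.IsStep.a_pos (h : τ.IsStep O Lf R r ε x₀ t) (P : Problem f O Lf R r ε) :
    0 < τ.a (t + 1) :=
  coeff_pos (h.lam_pos P) h.a_eq

theorem Trace.IsStep.lam_mul_sq (h : τ.IsStep O Lf R r ε x₀ t) (P : Problem f O Lf R r ε)
    (hA : 0 ≤ τ.A t) : τ.lam (t + 1) * τ.a (t + 1) ^ 2 = τ.A (t + 1) := by
  rw [h.A_eq]
  exact coeff_sq (h.lam_pos P) hA h.a_eq

theorem Trace.IsStep.A_pos (h : τ.IsStep O Lf R r ε x₀ t) (P : Problem f O Lf R r ε)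
    (hA : 0 ≤ τ.A t) : 0 < τ.A (t + 1) := by
  rw [h.A_eq]
  exact add_pos_of_nonneg_of_pos hA (h.a_pos P)

theorem Trace.IsStep.bisectPoint_eq (h : τ.IsStep O Lf R r ε x₀ t) (P : Problem f O Lf R r ε)
    (hA : 0 ≤ τ.A t) : bisectPoint (τ.x t) (τ.v t) (τ.A t) (τ.lam (t + 1)) = τ.y t := by
  have h1 := (h.A_pos P hA).ne'
  have h2 : 1 - τ.A t / τ.A (t + 1) = τ.a (t + 1) / τ.A (t + 1) := by
    rw [sub_eq_iff_eq_add, ← add_div, add_comm, ← h.A_eq, div_self h1]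
  rw [bisectPoint, alpha_coeff (h.lam_pos P) hA h.a_eq, ← h.A_eq, h2, h.y_eq]

theorem Trace.IsStep.y_mem (h : τ.IsStep O Lf R r ε x₀ t) (P : Problem f O Lf R r ε)
    (hA : 0 ≤ τ.A t) {s : Set (Pt d)} (hs : Convex ℝ s) (hx : τ.x t ∈ s) (hv : τ.v t ∈ s) :
    τ.y t ∈ s := by
  have h1 := h.A_pos P hA
  rw [h.y_eq]
  refine hs hx hv (by positivity) (div_nonneg (h.a_pos P).le h1.le) ?_
  rw [← add_div, ← h.A_eq, div_self h1.ne']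

theorem Trace.acc_pos (P : Problem f O Lf R r ε) (hlam : 0 < τ.lam t) : 0 < τ.acc R ε t := by
  have := P.R_pos
  have := P.eps_pos
  rw [Trace.acc]
  positivity

theorem Trace.lam_mul_acc (P : Problem f O Lf R r ε) (hlam : 0 < τ.lam t) :
    τ.lam t * τ.acc R ε t * R = ε / 12 := by
  have := P.R_pos
  rw [Trace.acc]
  field_simp

theorem Trace.acc_le (P : Problem f O Lf R r ε) (hlam : ε / (6 * r * R) ≤ τ.lam t) :
    τ.acc R ε t ≤ r / 2 := by
  have hR := P.R_pos
  have hr := P.r_pos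
  have h0 := P.lamMin_pos.trans_le hlam
  rw [div_le_iff₀ (by positivity)] at hlam
  rw [Trace.acc, div_le_iff₀ (by positivity)]
  linarith

theorem Trace.acc_le_of_lt (P : Problem f O Lf R r ε) (hlam : ε / (3 * r * R) < τ.lam t) :
    τ.acc R ε t ≤ r / 4 := by
  have hR := P.R_pos
  have hr := P.r_pos
  have hε := P.eps_pos
  have h0 : 0 < τ.lam t := lt_trans (by positivity) hlam
  rw [div_lt_iff₀ (by positivity)] at hlam
  rw [Trace.acc, div_le_iff₀ (by positivity)]
  linarith

theorem Trace.IsStep.exists_prox (h : τ.IsStep O Lf R r ε x₀ t) (P : Problem f O Lf R r ε)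
    (hA : 0 ≤ τ.A t) (hxv : ‖τ.x t - τ.v t‖ ≤ 2 * R) :
    ∃ p, IsProx f (τ.lam (t + 1)) (τ.y t) p ∧ ‖τ.y t - p‖ < r ∧
      (ε / (3 * r * R) < τ.lam (t + 1) → 3 * r / 4 ≤ ‖τ.y t - p‖) ∧
      ‖τ.x (t + 1) - p‖ ≤ τ.acc R ε (t + 1) ∧
      f (τ.x (t + 1)) + τ.lam (t + 1) / 2 * ‖τ.x (t + 1) - τ.y t‖ ^ 2
        ≤ f p + τ.lam (t + 1) / 2 * ‖p - τ.y t‖ ^ 2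
          + τ.lam (t + 1) / 2 * τ.acc R ε (t + 1) ^ 2 := by
  have hlam := h.lam_pos P
  have hacc := Trace.acc_pos P hlam
  obtain ⟨p, hp⟩ := exists_isProx P.convex P.lipschitz hlam (τ.y t)
  have h1 := h.lam_eq.norm_spec P.convex P.lipschitz P.Lf_pos P.broo P.r_pos P.R_pos hxv hA
    P.lamMin_pos P.range_le (p := p) (by rwa [h.bisectPoint_eq P hA])
  rw [h.bisectPoint_eq P hA] at h1
  have h2 : 2 * (ε / (6 * r * R)) = ε / (3 * r * R) := by
    have := P.R_pos
    have := P.r_pos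
    field_simp
    ring
  rw [h2] at h1
  have h3 := P.broo.norm_sub_le hlam hacc hp h1.1.le
  have h4 := P.broo _ _ (τ.y t) hlam hacc p
    (by rw [Metric.mem_closedBall, dist_comm, dist_eq_norm]; exact h1.1.le)
  rw [← h.x_eq] at h3 h4
  exact ⟨p, hp, h1.1, h1.2, h3, h4⟩

theorem Trace.IsStep.inner_nonneg (h : τ.IsStep O Lf R r ε x₀ t) {u : Pt d}
    (hu : u ∈ Metric.closedBall x₀ R) :
    0 ≤ τ.a (t + 1) * τ.lam (t + 1) * inner ℝ (τ.y t - τ.x (t + 1)) (u - τ.v (t + 1))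
      + inner ℝ (τ.v (t + 1) - τ.v t) (u - τ.v (t + 1)) :=
  inner_nonneg_of_isMinOn (convex_closedBall x₀ R) h.v_mem hu h.v_min

theorem Trace.IsStep.potential (h : τ.IsStep O Lf R r ε x₀ t) (P : Problem f O Lf R r ε)
    (hA : 0 ≤ τ.A t) (hxv : ‖τ.x t - τ.v t‖ ≤ 2 * R) (hlam : ε / (3 * r * R) < τ.lam (t + 1))
    (hv : τ.v t ∈ Metric.closedBall x₀ R) {u : Pt d} (hu : u ∈ Metric.closedBall x₀ R) :
    τ.A (t + 1) * (f (τ.x (t + 1)) - f u) + 1 / 2 * ‖τ.v (t + 1) - u‖ ^ 2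
        + r ^ 2 / 4 * (τ.lam (t + 1) * τ.A (t + 1))
      ≤ τ.A t * (f (τ.x t) - f u) + 1 / 2 * ‖τ.v t - u‖ ^ 2 + τ.a (t + 1) * (ε / 6) := by
  obtain ⟨p, hp, -, h1, h2, h3⟩ := h.exists_prox P hA hxv
  have hl := h.lam_pos P
  have ha := h.a_pos P
  have hA' := h.A_pos P hA
  have hr := P.r_pos
  have hy : τ.A (t + 1) • τ.y t = τ.A t • τ.x t + τ.a (t + 1) • τ.v t := by
    rw [h.y_eq, smul_add, smul_smul, smul_smul, mul_div_cancel₀ _ hA'.ne',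
      mul_div_cancel₀ _ hA'.ne']
  have h4 := hp.potential_step hA ha.le h.A_eq (h.lam_mul_sq P hA) hy h3 (h.inner_nonneg hu)
  have h5 : ‖τ.v t - u‖ ≤ 2 * R := by
    have := dist_triangle_right (τ.v t) u x₀
    rw [dist_eq_norm] at this
    linarith [Metric.mem_closedBall.1 hv, Metric.mem_closedBall.1 hu]
  have h6 : inner ℝ (τ.x (t + 1) - p) (τ.v t - u) ≤ τ.acc R ε (t + 1) * (2 * R) :=
    (real_inner_le_norm _ _).trans (mul_le_mul h2 h5 (norm_nonneg _) (Trace.acc_pos P hl).le)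
  have h7 : τ.a (t + 1) * τ.lam (t + 1) * inner ℝ (τ.x (t + 1) - p) (τ.v t - u)
      ≤ τ.a (t + 1) * (ε / 6) := by
    have h8 := mul_le_mul_of_nonneg_left h6 (mul_pos ha hl).le
    have h9 := Trace.lam_mul_acc P hl
    calc _ ≤ _ := h8
      _ = τ.a (t + 1) * (2 * (τ.lam (t + 1) * τ.acc R ε (t + 1) * R)) := by ring
      _ = _ := by rw [h9]; ring
  -- The displacement is at least `3r/4` and the accuracy at most `r/4`: `9/16 - 1/16 = 1/2`.
  have h8 : r ^ 2 / 2 ≤ ‖τ.y t - p‖ ^ 2 - τ.acc R ε (t + 1) ^ 2 := by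
    have h9 := Trace.acc_le_of_lt P hlam
    have h10 := Trace.acc_pos P hl
    have h11 := pow_le_pow_left₀ (by positivity) (h1 hlam) 2
    have h12 := pow_le_pow_left₀ h10.le h9 2
    linarith
  have h9 := mul_le_mul_of_nonneg_left h8
    (by positivity : 0 ≤ 1 / 2 * τ.lam (t + 1) * τ.A (t + 1))
  linarith

theorem Trace.IsStep.norm_x_sub_le (h : τ.IsStep O Lf R r ε x₀ t) (P : Problem f O Lf R r ε)
    (hA : 0 ≤ τ.A t) (hxv : ‖τ.x t - τ.v t‖ ≤ 2 * R) {u : Pt d} (hx : ‖τ.x t - u‖ ≤ R)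
    (hv : ‖τ.v t - u‖ ≤ R) (hgap : ε ≤ f (τ.x (t + 1)) - f u) : ‖τ.x (t + 1) - u‖ ≤ R := by
  obtain ⟨p, hp, -, -, h2, h3⟩ := h.exists_prox P hA hxv
  have hl := h.lam_pos P
  have h4 := add_mul_norm_sq_le (u := u) hp h3 hl.le
  have h5 := mem_closedBall_iff_norm.1 (h.y_mem P hA (convex_closedBall u R)
    (mem_closedBall_iff_norm.2 hx) (mem_closedBall_iff_norm.2 hv))
  have h6 := Trace.lam_mul_acc P hl
  have h7 := Trace.acc_le P (h.le_lam P)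
  have h8 := Trace.acc_pos P hl
  -- With accuracy `δ`, one has `ε = 12 λ δ R`, so a gap of `ε` gives `‖p - u‖² ≤ R² + δ² - 24 δ R ≤
  -- (R - δ)²`. The margin `δ` absorbs `‖x' - p‖`, where `x'` is the oracle answer.
  have h9 : ‖p - u‖ ≤ R - τ.acc R ε (t + 1) := by
    refine le_of_sq_le_sq ?_ (by linarith [P.r_le, P.r_pos])
    have h10 := pow_le_pow_left₀ (norm_nonneg _) h5 2
    have h11 : 12 * (τ.lam (t + 1) * τ.acc R ε (t + 1) * R) + τ.lam (t + 1) / 2 * ‖p - u‖ ^ 2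
        ≤ τ.lam (t + 1) / 2 * R ^ 2 + τ.lam (t + 1) / 2 * τ.acc R ε (t + 1) ^ 2 := by
      have := mul_le_mul_of_nonneg_left h10 (half_pos hl).le
      linarith
    refine le_of_mul_le_mul_left ?_ (half_pos hl)
    have h12 : 0 < τ.lam (t + 1) * τ.acc R ε (t + 1) * R := by
      rw [h6]; linarith [P.eps_pos]
    linarith
  have h10 := norm_sub_le_norm_sub_add_norm_sub (τ.x (t + 1)) p u
  linarith

/-- The proximal point moves by less than `r` at distance at most `R` from `u`, so the proximal
inequality bounds the gap by `(λ/2)(2rR + rR)`, which is at most `ε/2`. -/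
theorem Trace.IsStep.gap_le_of_lam_le (h : τ.IsStep O Lf R r ε x₀ t) (P : Problem f O Lf R r ε)
    (hA : 0 ≤ τ.A t) (hxv : ‖τ.x t - τ.v t‖ ≤ 2 * R) {u : Pt d} (hx : ‖τ.x t - u‖ ≤ R)
    (hv : ‖τ.v t - u‖ ≤ R) (hlam : τ.lam (t + 1) ≤ ε / (3 * r * R)) :
    f (τ.x (t + 1)) - f u ≤ ε := by
  obtain ⟨p, hp, h1, -, h2, h3⟩ := h.exists_prox P hA hxv
  have hl := h.lam_pos P
  have hr := P.r_pos
  have hR := P.R_pos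
  have h4 := add_mul_norm_sq_le (u := u) hp h3 hl.le
  have h5 := mem_closedBall_iff_norm.1 (h.y_mem P hA (convex_closedBall u R)
    (mem_closedBall_iff_norm.2 hx) (mem_closedBall_iff_norm.2 hv))
  have h7 := Trace.acc_le P (h.le_lam P)
  have h8 := Trace.acc_pos P hl
  have h9 : ‖τ.y t - u‖ ^ 2 - ‖p - u‖ ^ 2 ≤ 2 * r * R := by
    have h10 := norm_sub_le_norm_sub_add_norm_sub (τ.y t) p u
    have h11 := norm_nonneg (p - u)
    rcases le_total ‖τ.y t - u‖ ‖p - u‖ with h12 | h12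
    · have := pow_le_pow_left₀ (norm_nonneg _) h12 2
      nlinarith [mul_pos hr hR]
    · have h13 : (‖τ.y t - u‖ - ‖p - u‖) * (‖τ.y t - u‖ + ‖p - u‖) ≤ r * (2 * R) :=
        mul_le_mul (by linarith) (by linarith) (by positivity) hr.le
      linarith
  have h10 : τ.acc R ε (t + 1) ^ 2 ≤ r * R := by
    have := P.r_le
    nlinarith
  have h11 : τ.lam (t + 1) / 2 * (3 * r * R) ≤ ε / 2 := by
    rw [le_div_iff₀ (by positivity)] at hlam
    linarith
  have h12 := mul_le_mul_of_nonneg_left (add_le_add h9 h10) (half_pos hl).le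
  linarith [P.eps_pos]

end Step

/-- The trace follows the algorithm for `n` iterations, in none of which the bisection ends at the
lower end of its range. -/
structure Trace.Run {d : ℕ} (τ : Trace d) (O : ℝ → ℝ → Pt d → Pt d) (Lf R r ε : ℝ) (x₀ : Pt d)
    (n : ℕ) : Prop where
  x_zero : τ.x 0 = x₀
  v_zero : τ.v 0 = x₀
  A_zero : τ.A 0 = 0
  step : ∀ t < n, τ.IsStep O Lf R r ε x₀ t
  near : ∀ t < n, ‖τ.x t - τ.v t‖ ≤ 2 * R
  lam_gt : ∀ t < n, ε / (3 * r * R) < τ.lam (t + 1)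

/-! ### Summed potential, and iterates staying near the minimizer -/

section Run

variable {d : ℕ} {f : Pt d → ℝ} {Lf : ℝ≥0} {r R ε : ℝ} {O : ℝ → ℝ → Pt d → Pt d} {x₀ : Pt d}
  {τ : Trace d} {n : ℕ}

theorem Trace.Run.mono (h : τ.Run O Lf R r ε x₀ n) {m : ℕ} (hmn : m ≤ n) :
    τ.Run O Lf R r ε x₀ m :=
  ⟨h.x_zero, h.v_zero, h.A_zero, fun t ht => h.step t (ht.trans_le hmn),
    fun t ht => h.near t (ht.trans_le hmn), fun t ht => h.lam_gt t (ht.trans_le hmn)⟩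

theorem Trace.Run.A_nonneg (h : τ.Run O Lf R r ε x₀ n) (P : Problem f O Lf R r ε) :
    0 ≤ τ.A n := by
  induction n with
  | zero => exact h.A_zero.ge
  | succ n ih =>
    exact ((h.step n n.lt_succ_self).A_pos P (ih (h.mono n.le_succ))).le

theorem Trace.Run.v_mem (h : τ.Run O Lf R r ε x₀ n) (P : Problem f O Lf R r ε) :
    τ.v n ∈ Metric.closedBall x₀ R := by
  cases n with
  | zero => rw [h.v_zero]; exact Metric.mem_closedBall_self P.R_pos.le
  | succ n => exact (h.step n n.lt_succ_self).v_mem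

theorem Trace.Run.potential (h : τ.Run O Lf R r ε x₀ n) (P : Problem f O Lf R r ε) {u : Pt d}
    (hu : u ∈ Metric.closedBall x₀ R) :
    τ.A n * (f (τ.x n) - f u) + 1 / 2 * ‖τ.v n - u‖ ^ 2
        + r ^ 2 / 4 * ∑ i ∈ Finset.range n, τ.lam (i + 1) * τ.A (i + 1)
      ≤ 1 / 2 * R ^ 2 + τ.A n * (ε / 6) := by
  induction n with
  | zero =>
    rw [h.A_zero, h.v_zero]
    have h1 := mem_closedBall_iff_norm'.1 hu
    have h2 := pow_le_pow_left₀ (norm_nonneg _) h1 2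
    simp only [Finset.range_zero, Finset.sum_empty]
    linarith
  | succ n ih =>
    have h' := h.mono n.le_succ
    have hs := h.step n n.lt_succ_self
    have h1 := hs.potential P (h'.A_nonneg P) (h.near n n.lt_succ_self)
      (h.lam_gt n n.lt_succ_self) (h'.v_mem P) hu
    have h2 := ih h'
    have h3 : τ.A (n + 1) * (ε / 6) = τ.A n * (ε / 6) + τ.a (n + 1) * (ε / 6) := by
      rw [hs.A_eq]; ring
    rw [Finset.sum_range_succ]
    linarith

theorem Trace.Run.sum_nonneg (h : τ.Run O Lf R r ε x₀ n) (P : Problem f O Lf R r ε) :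
    0 ≤ ∑ i ∈ Finset.range n, τ.lam (i + 1) * τ.A (i + 1) := by
  refine Finset.sum_nonneg fun i hi => ?_
  have hi' := Finset.mem_range.1 hi
  exact mul_nonneg ((h.step i hi').lam_pos P).le ((h.mono hi').A_nonneg P)

theorem Trace.Run.gap_le_of_le_A (h : τ.Run O Lf R r ε x₀ n) (P : Problem f O Lf R r ε) {u : Pt d}
    (hu : u ∈ Metric.closedBall x₀ R) (hA : R ^ 2 / ε ≤ τ.A n) : f (τ.x n) - f u ≤ ε := by
  have h1 := h.potential P hu
  have h2 := h.sum_nonneg P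
  have hR := P.R_pos
  have hε := P.eps_pos
  have h3 : 0 < τ.A n := lt_of_lt_of_le (by positivity) hA
  rw [div_le_iff₀ hε] at hA
  refine le_of_mul_le_mul_left ?_ h3
  have h4 : 0 ≤ r ^ 2 / 4 * ∑ i ∈ Finset.range n, τ.lam (i + 1) * τ.A (i + 1) := by positivity
  have h5 : 0 ≤ 1 / 2 * ‖τ.v n - u‖ ^ 2 := by positivity
  have h6 := mul_pos h3 hε
  linarith

theorem Trace.Run.norm_v_sub_le (h : τ.Run O Lf R r ε x₀ n) (P : Problem f O Lf R r ε) {u : Pt d}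
    (hu : u ∈ Metric.closedBall x₀ R) (hgap : ε ≤ f (τ.x n) - f u) : ‖τ.v n - u‖ ≤ R := by
  have h1 := h.potential P hu
  have h2 : 0 ≤ r ^ 2 / 4 * ∑ i ∈ Finset.range n, τ.lam (i + 1) * τ.A (i + 1) :=
    mul_nonneg (by positivity) (h.sum_nonneg P)
  have h3 := mul_le_mul_of_nonneg_left hgap (h.A_nonneg P)
  have h4 := mul_nonneg (h.A_nonneg P) P.eps_pos.le
  refine le_of_sq_le_sq ?_ P.R_pos.le
  linarith

theorem Trace.Run.norm_x_sub_le (h : τ.Run O Lf R r ε x₀ n) (P : Problem f O Lf R r ε) {u : Pt d}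
    (hu : u ∈ Metric.closedBall x₀ R) (hgap : ∀ i ≤ n, ε ≤ f (τ.x i) - f u) :
    ‖τ.x n - u‖ ≤ R := by
  induction n with
  | zero => rw [h.x_zero]; exact mem_closedBall_iff_norm'.1 hu
  | succ n ih =>
    have h' := h.mono n.le_succ
    exact (h.step n n.lt_succ_self).norm_x_sub_le P (h'.A_nonneg P) (h.near n n.lt_succ_self)
      (ih h' fun i hi => hgap i (hi.trans n.le_succ)) (h'.norm_v_sub_le P hu (hgap n n.le_succ))
      (hgap (n + 1) le_rfl)

end Run

/-! ### Growth of `A` in the second iteration -/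

section FirstSteps

variable {d : ℕ} {f : Pt d → ℝ} {Lf : ℝ≥0} {r R ε : ℝ} {O : ℝ → ℝ → Pt d → Pt d} {x₀ : Pt d}
  {τ : Trace d}

theorem Trace.IsStep.a_one (h : τ.IsStep O Lf R r ε x₀ 0) (hA : τ.A 0 = 0) :
    τ.a 1 = 1 / τ.lam 1 := by
  have := h.a_eq
  rw [hA, mul_zero, add_zero, Real.sqrt_one] at this
  rw [this, zero_add]
  ring

theorem Trace.IsStep.A_one (h : τ.IsStep O Lf R r ε x₀ 0) (hA : τ.A 0 = 0) :
    τ.A 1 = 1 / τ.lam 1 := by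
  have := h.A_eq
  rw [hA, zero_add, zero_add] at this
  rw [this, h.a_one hA]

theorem Trace.IsStep.y_zero (h : τ.IsStep O Lf R r ε x₀ 0) (hA : τ.A 0 = 0)
    (hlam : τ.lam 1 ≠ 0) (hv : τ.v 0 = x₀) : τ.y 0 = x₀ := by
  rw [h.y_eq, zero_add, hA, h.A_one hA, h.a_one hA, hv, zero_div, zero_smul, zero_add,
    div_self (by simpa using hlam), one_smul]

/-- The regularization cannot grow fast in the second iteration. -/
theorem Trace.Run.lam_two_le (h : τ.Run O Lf R r ε x₀ 2) (P : Problem f O Lf R r ε) :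
    τ.lam 2 ≤ 4 * τ.lam 1 := by
  have s0 := h.step 0 two_pos
  have s1 := h.step 1 one_lt_two
  have hl1 : 0 < τ.lam 1 := s0.lam_pos P
  have hl2 : 0 < τ.lam 2 := s1.lam_pos P
  have hy0 := s0.y_zero h.A_zero hl1.ne' h.v_zero
  obtain ⟨p, hp, h1, -, h2, -⟩ := s0.exists_prox P h.A_zero.ge (h.near 0 two_pos)
  obtain ⟨p', hp', -, h1', -, -⟩ := s1.exists_prox P ((h.mono one_le_two).A_nonneg P)
    (h.near 1 one_lt_two)
  have hD := h1' (h.lam_gt 1 one_lt_two)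
  simp only [zero_add, Nat.reduceAdd] at hp h2 hp' hD
  rw [hy0] at hp h1
  have hδ : τ.acc R ε 1 ≤ r / 4 := Trace.acc_le_of_lt P (h.lam_gt 0 two_pos)
  have hpmem : p ∈ Metric.closedBall x₀ R :=
    mem_closedBall_iff_norm'.2 (h1.le.trans P.r_le)
  -- Here `a λ = 1` and `y 0 = v 0`, so `v 1` is the projection of `x 1` onto a ball containing `p`,
  -- hence no farther from `p`.
  have hv1 : ‖τ.v 1 - p‖ ≤ τ.acc R ε 1 := by
    have h3 := s0.inner_nonneg hpmem
    simp only [zero_add] at h3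
    rw [s0.a_one h.A_zero, one_div_mul_cancel hl1.ne', one_mul, ← inner_add_left, hy0, h.v_zero,
      show x₀ - τ.x 1 + (τ.v 1 - x₀) = (τ.v 1 - p) - (τ.x 1 - p) by abel,
      show p - τ.v 1 = -(τ.v 1 - p) by abel, inner_neg_right, inner_sub_left,
      real_inner_self_eq_norm_sq] at h3
    have h4 : ‖τ.v 1 - p‖ ^ 2 ≤ ‖τ.x 1 - p‖ * ‖τ.v 1 - p‖ := by
      linarith [real_inner_le_norm (τ.x 1 - p) (τ.v 1 - p)]
    rcases (norm_nonneg (τ.v 1 - p)).eq_or_lt with h5 | h5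
    · rw [← h5]; exact (norm_nonneg _).trans h2
    · refine le_trans (le_of_mul_le_mul_right ?_ h5) h2
      linarith
  have hy1 := mem_closedBall_iff_norm.1 (s1.y_mem P ((h.mono one_le_two).A_nonneg P)
    (convex_closedBall p _) (mem_closedBall_iff_norm.2 h2) (mem_closedBall_iff_norm.2 hv1))
  -- This point has the same proximal point `p` under `λ₂`, since the subgradient is unchanged. If
  -- `λ₂` were much larger than `λ₁`, `z` would be near `p`, as `y 1` is, and nonexpansiveness would
  -- leave `y 1` a displacement below `3r/4`.
  set z := p + (τ.lam 1 / τ.lam 2) • (x₀ - p) with hz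
  have hzp : z - p = (τ.lam 1 / τ.lam 2) • (x₀ - p) := by rw [hz]; abel
  have hpz : IsProx f (τ.lam 2) z p := by
    intro u
    rw [hzp, inner_smul_left, conj_trivial, ← mul_assoc, mul_div_cancel₀ _ hl2.ne']
    exact hp u
  have h6 := hp'.norm_sub_sub_le hl2 hpz
  have h7 : ‖z - p‖ ≤ τ.lam 1 / τ.lam 2 * r := by
    rw [hzp, norm_smul, Real.norm_of_nonneg (by positivity)]
    gcongr
  have h8 := norm_sub_norm_le (τ.y 1 - p') (z - p)
  have h9 := norm_sub_le_norm_sub_add_norm_sub (τ.y 1) p z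
  rw [norm_sub_rev p z] at h9
  have h10 : 1 / 4 * r ≤ τ.lam 1 / τ.lam 2 * r := by linarith
  have h11 := le_of_mul_le_mul_right h10 P.r_pos
  rw [div_le_div_iff₀ (by norm_num) hl2] at h11
  linarith

theorem Trace.Run.A_two_ge (h : τ.Run O Lf R r ε x₀ 2) (P : Problem f O Lf R r ε) :
    3 / 2 * τ.A 1 ≤ τ.A 2 := by
  have s0 := h.step 0 two_pos
  have s1 := h.step 1 one_lt_two
  have hl1 : 0 < τ.lam 1 := s0.lam_pos P
  have hl2 : 0 < τ.lam 2 := s1.lam_pos P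
  have ha2 : 0 < τ.a 2 := s1.a_pos P
  have hA1 := s0.A_one h.A_zero
  have hA1p : 0 < τ.A 1 := by rw [hA1]; positivity
  have hA2 : τ.A 2 = τ.A 1 + τ.a 2 := s1.A_eq
  have hsq : τ.lam 2 * τ.a 2 ^ 2 = τ.A 2 := s1.lam_mul_sq P hA1p.le
  have hle := h.lam_two_le P
  have h1 : τ.lam 1 * τ.A 1 = 1 := by rw [hA1]; field_simp
  by_contra! hlt
  have h2 : τ.a 2 < τ.A 1 / 2 := by linarith
  have h3 : τ.lam 2 * τ.a 2 ^ 2 ≤ 4 * τ.lam 1 * (τ.A 1 / 2) ^ 2 := by gcongr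
  have h4 : 4 * τ.lam 1 * (τ.A 1 / 2) ^ 2 = τ.lam 1 * τ.A 1 * τ.A 1 := by ring
  rw [h1, one_mul] at h4
  linarith

end FirstSteps

/-! ### Exponential growth of `A` while the gap is large -/

section Growth

variable {d : ℕ} {f : Pt d → ℝ} {Lf : ℝ≥0} {r R ε : ℝ} {O : ℝ → ℝ → Pt d → Pt d} {x₀ : Pt d}
  {τ : Trace d}

/-- For `q > 0`, the tangent to the convex function `s ↦ s ^ (-1/2)` at the point where its value is
`2q/3`. Being linear in `s`, it can be summed over iterations in place of a power mean inequality.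
-/
theorem sub_le_of_sq_mul_eq_one {q θ s : ℝ} (hq : 0 ≤ q) (hθ : 0 < θ) (h : θ ^ 2 * s = 1) :
    q - 4 / 27 * q ^ 3 * s ≤ θ := by
  have h1 : 0 ≤ (θ - 2 * q / 3) ^ 2 * (θ + q / 3) := by positivity
  refine le_of_mul_le_mul_left ?_ (pow_pos hθ 2)
  have h2 : θ ^ 2 * (q - 4 / 27 * q ^ 3 * s) = θ ^ 2 * q - 4 / 27 * q ^ 3 * (θ ^ 2 * s) := by ring
  rw [h2, h]
  nlinarith

theorem Trace.IsStep.le_log_sub_log {t : ℕ} (h : τ.IsStep O Lf R r ε x₀ t)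
    (P : Problem f O Lf R r ε) (hA : 0 < τ.A t) {q : ℝ} (hq : 0 ≤ q) :
    q - 4 / 27 * q ^ 3 * (τ.lam (t + 1) * τ.A (t + 1))
      ≤ Real.log (τ.A (t + 1)) - Real.log (τ.A t) := by
  have hA' := h.A_pos P hA.le
  have ha := h.a_pos P
  have h1 := Real.one_sub_inv_le_log_of_pos (div_pos hA' hA)
  rw [Real.log_div hA'.ne' hA.ne', inv_div] at h1
  have h2 : 1 - τ.A t / τ.A (t + 1) = τ.a (t + 1) / τ.A (t + 1) := by
    rw [sub_eq_iff_eq_add, ← add_div, add_comm, ← h.A_eq, div_self hA'.ne']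
  rw [h2] at h1
  refine (sub_le_of_sq_mul_eq_one hq (div_pos ha hA') ?_).trans h1
  have h3 := h.lam_mul_sq P hA.le
  have h4 : (τ.a (t + 1) / τ.A (t + 1)) ^ 2 * (τ.lam (t + 1) * τ.A (t + 1))
      = τ.lam (t + 1) * τ.a (t + 1) ^ 2 / τ.A (t + 1) := by field_simp
  rw [h4, h3, div_self hA'.ne']

theorem Trace.Run.log_A_ge {n : ℕ} (h : τ.Run O Lf R r ε x₀ (n + 2)) (P : Problem f O Lf R r ε)
    {q : ℝ} (hq : 0 ≤ q) :
    Real.log (τ.A 2) + q * n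
        - 4 / 27 * q ^ 3 * ∑ i ∈ Finset.range (n + 2), τ.lam (i + 1) * τ.A (i + 1)
      ≤ Real.log (τ.A (n + 2)) := by
  induction n with
  | zero =>
    have h1 := mul_nonneg (by positivity : 0 ≤ 4 / 27 * q ^ 3) (h.sum_nonneg P)
    push_cast
    simp only [zero_add] at h1 ⊢
    linarith
  | succ n ih =>
    have h' := h.mono (Nat.le_succ (n + 2))
    have h1 := ih h'
    have hA : 0 < τ.A (n + 2) :=
      (h.step (n + 1) (by omega)).A_pos P ((h.mono (by omega)).A_nonneg P)
    have h2 := (h.step (n + 2) (by omega)).le_log_sub_log P hA hq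
    rw [show n + 1 + 2 = n + 2 + 1 by ring, Finset.sum_range_succ]
    push_cast
    linarith

theorem rpow_two_thirds_pow_three {x : ℝ} (hx : 0 ≤ x) : (x ^ (2 / 3 : ℝ)) ^ 3 = x ^ 2 := by
  rw [← Real.rpow_natCast, ← Real.rpow_mul hx]
  norm_num

theorem Trace.Run.exp_mul_le {n : ℕ} (h : τ.Run O Lf R r ε x₀ (n + 1)) (P : Problem f O Lf R r ε)
    {u : Pt d} (hu : u ∈ Metric.closedBall x₀ R) (hgap : ε ≤ f (τ.x (n + 1)) - f u) :
    Real.exp (r ^ (2 / 3 : ℝ) / R ^ (2 / 3 : ℝ) * ((n : ℝ) - 1)) * τ.A 1 ≤ τ.A (n + 1) := by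
  have hr := P.r_pos
  have hR := P.R_pos
  set q := r ^ (2 / 3 : ℝ) / R ^ (2 / 3 : ℝ) with hqdef
  have hq : 0 < q := by positivity
  have hq3 : q ^ 3 = r ^ 2 / R ^ 2 := by
    rw [hqdef, div_pow, rpow_two_thirds_pow_three hr.le, rpow_two_thirds_pow_three hR.le]
  have hA1 : 0 < τ.A 1 := (h.step 0 n.succ_pos).A_pos P h.A_zero.ge
  cases n with
  | zero =>
    have : Real.exp (q * (((0 : ℕ) : ℝ) - 1)) ≤ 1 := by
      rw [Real.exp_le_one_iff]
      push_cast
      linarith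
    simpa using mul_le_mul_of_nonneg_right this hA1.le
  | succ n =>
    have h1 := h.log_A_ge P hq.le
    have h2 := h.potential P hu
    have h3 := mul_le_mul_of_nonneg_left hgap (h.A_nonneg P)
    have h4 := mul_nonneg (h.A_nonneg P) P.eps_pos.le
    have h5 : 0 ≤ 1 / 2 * ‖τ.v (n + 1 + 1) - u‖ ^ 2 := by positivity
    have hA2 := (h.mono (by omega : 2 ≤ n + 1 + 1)).A_two_ge P
    have hA' : 0 < τ.A (n + 1 + 1) :=
      (h.step (n + 1) (by omega)).A_pos P ((h.mono (by omega)).A_nonneg P)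
    set S := ∑ i ∈ Finset.range (n + 2), τ.lam (i + 1) * τ.A (i + 1)
    -- Therefore the total loss is at most `8/27`, less than the `1/3` gained from `A 2 ≥ (3/2) A
    -- 1`; this leaves the growth test without any constant factor.
    have h6 : q ^ 3 * S ≤ 2 := by
      have h7 : r ^ 2 * S ≤ 2 * R ^ 2 := by linarith
      rw [hq3, div_mul_eq_mul_div, div_le_iff₀ (by positivity)]
      exact h7
    have h8 : Real.log (τ.A 1) + 1 / 3 ≤ Real.log (τ.A 2) := by
      have h9 := Real.log_le_log (by positivity) hA2
      rw [Real.log_mul (by norm_num) hA1.ne'] at h9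
      have h10 := Real.one_sub_inv_le_log_of_pos (by norm_num : (0 : ℝ) < 3 / 2)
      norm_num at h10 h9
      linarith
    rw [← Real.log_le_log_iff (by positivity) hA',
      Real.log_mul (Real.exp_pos _).ne' hA1.ne', Real.log_exp]
    push_cast
    rw [add_sub_cancel_right]
    linarith

end Growth

/-! ### The minimum over the ball is attained -/

section BallMin

variable {d : ℕ} {f : Pt d → ℝ} {x₀ : Pt d} {R : ℝ}

theorem exists_eq_ballMin (hf : Continuous f) (hR : 0 ≤ R) (x₀ : Pt d) :
    ∃ u ∈ Metric.closedBall x₀ R, ballMin f x₀ R = f u ∧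
      ∀ z ∈ Metric.closedBall x₀ R, ballMin f x₀ R ≤ f z := by
  obtain ⟨u, hu, hmin⟩ := (isCompact_closedBall x₀ R).exists_isMinOn
    ⟨x₀, Metric.mem_closedBall_self hR⟩ hf.continuousOn
  have h : ballMin f x₀ R = f u :=
    IsLeast.csInf_eq ⟨Set.mem_image_of_mem f hu, by rintro _ ⟨z, hz, rfl⟩; exact hmin hz⟩
  exact ⟨u, hu, h, fun z hz => h ▸ hmin hz⟩

end BallMin

/-! ### Existence and termination of an execution -/

section Execution

variable {d : ℕ} {f : Pt d → ℝ} {Lf : ℝ≥0} {r R ε : ℝ} {O : ℝ → ℝ → Pt d → Pt d} {x₀ : Pt d}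

/-- The derived quantities enter through equations so that only `lam`, `qs` and `v'` have to be
chosen as functions of the state. -/
theorem exists_step (hr : 0 < r) (hR : 0 < R) (hε : 0 < ε) (hLf : 0 < Lf) (x v : Pt d) (A : ℝ) :
    ∃ (lam : ℝ) (qs : List Query) (v' : Pt d),
      Bisection (bisectGap O r x v A) r R Lf (2 * Lf / r) (ε / (6 * r * R)) lam qs ∧
      ∀ (a A' : ℝ) (y x' : Pt d), a = 1 / (2 * lam) * (1 + √(1 + 4 * lam * A)) → A' = A + a →
        y = (A / A') • x + (a / A') • v → x' = O lam (ε / (12 * lam * R)) y →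
        v' ∈ Metric.closedBall x₀ R ∧
        IsMinOn (fun w => a * lam * inner ℝ (y - x') w + 1 / 2 * ‖w - v‖ ^ 2)
          (Metric.closedBall x₀ R) v' := by
  obtain ⟨lam, qs, h⟩ := Bisection.exists (bisectGap O r x v A) hr hR (NNReal.coe_pos.2 hLf)
    (2 * Lf / r) (by positivity : 0 < ε / (6 * r * R))
  set a := 1 / (2 * lam) * (1 + √(1 + 4 * lam * A))
  set y := (A / (A + a)) • x + (a / (A + a)) • v
  set x' := O lam (ε / (12 * lam * R)) y
  obtain ⟨v', hv', hmin⟩ := (isCompact_closedBall x₀ R).exists_isMinOn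
    ⟨x₀, Metric.mem_closedBall_self hR.le⟩
    (by fun_prop : ContinuousOn
      (fun w => a * lam * inner ℝ (y - x') w + 1 / 2 * ‖w - v‖ ^ 2) (Metric.closedBall x₀ R))
  refine ⟨lam, qs, v', h, ?_⟩
  rintro _ _ _ _ rfl rfl rfl rfl
  exact ⟨hv', hmin⟩

theorem exists_trace (hr : 0 < r) (hR : 0 < R) (hε : 0 < ε) (hLf : 0 < Lf)
    (O : ℝ → ℝ → Pt d → Pt d) (x₀ : Pt d) :
    ∃ τ : Trace d, τ.x 0 = x₀ ∧ τ.v 0 = x₀ ∧ τ.A 0 = 0 ∧ ∀ t, τ.IsStep O Lf R r ε x₀ t := by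
  choose lam qs v' hbis hmin using
    fun x v A => exists_step (O := O) (x₀ := x₀) hr hR hε hLf x v A
  let a : Pt d → Pt d → ℝ → ℝ := fun x v A =>
    1 / (2 * lam x v A) * (1 + √(1 + 4 * lam x v A * A))
  let y : Pt d → Pt d → ℝ → Pt d := fun x v A =>
    (A / (A + a x v A)) • x + (a x v A / (A + a x v A)) • v
  let x' : Pt d → Pt d → ℝ → Pt d := fun x v A =>
    O (lam x v A) (ε / (12 * lam x v A * R)) (y x v A)
  let S : ℕ → Pt d × Pt d × ℝ := fun t => Nat.rec (x₀, x₀, 0)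
    (fun _ s => (x' s.1 s.2.1 s.2.2, v' s.1 s.2.1 s.2.2, s.2.2 + a s.1 s.2.1 s.2.2)) t
  refine ⟨{ x := fun t => (S t).1
            v := fun t => (S t).2.1
            A := fun t => (S t).2.2
            y := fun t => y (S t).1 (S t).2.1 (S t).2.2
            -- Entry `t + 1` is computed from state `t`; the entry at `0` is never read.
            a := fun t => a (S (t - 1)).1 (S (t - 1)).2.1 (S (t - 1)).2.2
            lam := fun t => lam (S (t - 1)).1 (S (t - 1)).2.1 (S (t - 1)).2.2
            bisQueries := fun t => qs (S t).1 (S t).2.1 (S t).2.2 }, rfl, rfl, rfl, fun t => ?_⟩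
  have h := hmin (S t).1 (S t).2.1 (S t).2.2 _ _ _ _ rfl rfl rfl rfl
  exact ⟨hbis _ _ _, rfl, rfl, rfl, rfl, h.1, h.2⟩

theorem Trace.IsStep.lam_pos' {τ : Trace d} {t : ℕ} (h : τ.IsStep O Lf R r ε x₀ t) (hr : 0 < r)
    (hR : 0 < R) (hε : 0 < ε) (hLf : 0 < Lf) : 0 < τ.lam (t + 1) := by
  have hm : 0 < ε / (6 * r * R) := by positivity
  rcases lt_or_ge (2 * Lf / r) (ε / (6 * r * R)) with hlt | hle
  · rw [(h.lam_eq.of_lt hlt).1]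
    positivity
  · exact hm.trans_le (h.lam_eq.bounds hm hle).1.1

/-- The growth test forces termination for any `O`: if passed forever, it pushes `A` beyond `R² /
ε`. -/
theorem exists_stops {τ : Trace d} (hr : 0 < r) (hR : 0 < R) (hε : 0 < ε) (hLf : 0 < Lf)
    (hA : τ.A 0 = 0) (h : ∀ t, τ.IsStep O Lf R r ε x₀ t) : ∃ t, τ.Stops R r ε t := by
  by_contra! hn
  have hl : 0 < τ.lam 1 := (h 0).lam_pos' hr hR hε hLf
  have hA1 : 0 < τ.A 1 := by rw [(h 0).A_one hA]; positivity
  set q := r ^ (2 / 3 : ℝ) / R ^ (2 / 3 : ℝ)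
  have hq : 0 < q := by positivity
  obtain ⟨t, ht⟩ := exists_nat_gt (R ^ 2 / ε / τ.A 1 / q + 1)
  have h1 := hn t
  simp only [Trace.Stops, not_or, not_lt, not_le] at h1
  have h2 : R ^ 2 / ε / τ.A 1 < q * ((t : ℝ) - 1) := by
    rw [← div_lt_iff₀' hq]
    linarith
  rw [div_lt_iff₀ hA1] at h2
  have h3 := mul_le_mul_of_nonneg_right (Real.add_one_le_exp (q * ((t : ℝ) - 1))) hA1.le
  linarith [h1.1, h1.2.2.2]

theorem exists_returns (f : Pt d → ℝ) (hr : 0 < r) (hR : 0 < R) (hε : 0 < ε) (hLf : 0 < Lf)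
    (O : ℝ → ℝ → Pt d → Pt d) (x₀ : Pt d) : ∃ x qs, Returns f O Lf R r ε x₀ x qs := by
  classical
  obtain ⟨τ, hx, hv, hA, hs⟩ := exists_trace hr hR hε hLf O x₀
  have hex := exists_stops hr hR hε hLf hA hs
  obtain ⟨i, hi, hmin⟩ := Finset.exists_min_image (Finset.range (Nat.find hex + 2))
    (fun i => f (τ.x i)) ⟨0, by simp⟩
  refine ⟨τ.x i, _, Nat.find hex, τ, hx, hv, hA, fun t _ => hs t, fun t ht => Nat.find_min hex ht,
    Nat.find_spec hex, ⟨i, ?_, rfl⟩, fun j hj => hmin j (Finset.mem_range.2 (by omega)), rfl⟩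
  have := Finset.mem_range.1 hi
  omega

end Execution

/-! ### Near-optimality at the stopping time -/

section Optimality

variable {d : ℕ} {f : Pt d → ℝ} {Lf : ℝ≥0} {r R ε : ℝ} {O : ℝ → ℝ → Pt d → Pt d} {x₀ : Pt d}
  {τ : Trace d} {N : ℕ}

theorem Trace.run_of_not_stops (P : Problem f O Lf R r ε) (hx : τ.x 0 = x₀) (hv : τ.v 0 = x₀)
    (hA : τ.A 0 = 0) (hs : ∀ t ≤ N, τ.IsStep O Lf R r ε x₀ t)
    (hn : ∀ t < N, ¬ τ.Stops R r ε t) :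
    τ.Run O Lf R r ε x₀ N ∧ ‖τ.x N - τ.v N‖ ≤ 2 * R := by
  simp only [Trace.Stops, not_or, not_lt, not_le] at hn
  have hnear : ∀ t ≤ N, ‖τ.x t - τ.v t‖ ≤ 2 * R := by
    intro t ht
    cases t with
    | zero =>
      rw [hx, hv, sub_self, norm_zero]
      linarith [P.R_pos]
    | succ t => exact (hn t (by omega)).2.2.1
  exact ⟨⟨hx, hv, hA, fun t ht => hs t ht.le, fun t ht => hnear t ht.le,
    fun t ht => (hn t ht).2.1⟩, hnear N le_rfl⟩

/-- When the algorithm stops, one of its iterates is nearly optimal. -/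
theorem Trace.Run.exists_gap_le (h : τ.Run O Lf R r ε x₀ N) (P : Problem f O Lf R r ε)
    (hnear : ‖τ.x N - τ.v N‖ ≤ 2 * R) (hs : τ.IsStep O Lf R r ε x₀ N)
    (hst : τ.Stops R r ε N) {u : Pt d} (hu : u ∈ Metric.closedBall x₀ R) :
    ∃ i ≤ N + 1, f (τ.x i) - f u ≤ ε := by
  by_contra! hgap
  have hx := h.norm_x_sub_le P hu fun i hi => (hgap i (by omega)).le
  have hv := h.norm_v_sub_le P hu (hgap N (by omega)).le
  rcases le_or_gt (τ.lam (N + 1)) (ε / (3 * r * R)) with hlam | hlam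
  · exact (hgap (N + 1) le_rfl).not_ge (hs.gap_le_of_lam_le P (h.A_nonneg P) hnear hx hv hlam)
  have hlast : ∀ {p : ℕ → Prop}, (∀ t < N, p t) → p N → ∀ t < N + 1, p t := by
    intro p h1 h2 t ht
    rcases Nat.lt_succ_iff_lt_or_eq.1 ht with ht | rfl
    · exact h1 t ht
    · exact h2
  have h' : τ.Run O Lf R r ε x₀ (N + 1) :=
    ⟨h.x_zero, h.v_zero, h.A_zero, hlast h.step hs, hlast h.near hnear, hlast h.lam_gt hlam⟩
  have hlt := hgap (N + 1) le_rfl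
  rcases hst with h1 | h1 | h1 | h1
  · exact hlt.not_ge (h'.gap_le_of_le_A P hu h1)
  · exact h1.not_gt hlam
  · have h2 := h'.norm_x_sub_le P hu fun i hi => (hgap i hi).le
    have h3 := h'.norm_v_sub_le P hu hlt.le
    have h4 := norm_sub_le_norm_sub_add_norm_sub (τ.x (N + 1)) u (τ.v (N + 1))
    rw [norm_sub_rev u] at h4
    linarith
  · exact h1.not_ge (h'.exp_mul_le P hu hlt.le)

end Optimality

/-! ### Iteration count and query cost -/

section Complexity

variable {d : ℕ} {f : Pt d → ℝ} {Lf : ℝ≥0} {r R ε : ℝ} {O : ℝ → ℝ → Pt d → Pt d} {x₀ : Pt d}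
  {τ : Trace d} {N : ℕ}

theorem one_le_rpow_div (hr : 0 < r) (hrR : r ≤ R) : 1 ≤ (R / r) ^ (2 / 3 : ℝ) :=
  Real.one_le_rpow ((one_le_div hr).2 hrR) (by norm_num)

theorem one_le_max_mul_div (hr : 0 < r) (hrR : r ≤ R) (hε : 0 < ε) (g : ℝ) :
    1 ≤ max g ε * R / (ε * r) := by
  rw [one_le_div (by positivity)]
  exact mul_le_mul (le_max_right _ _) hrR hr.le (hε.le.trans (le_max_right _ _))

/-- The first proximal step moves by at least `3r/4` inside the ball and decreases `f` by at least
`λ₁` times the squared displacement. This bounds `A 1 = 1 / λ₁` from below. -/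
theorem Trace.Run.lam_one_le (h : τ.Run O Lf R r ε x₀ 1) (P : Problem f O Lf R r ε) :
    τ.lam 1 * r ^ 2 ≤ 2 * max (f x₀ - ballMin f x₀ R) ε := by
  have s0 := h.step 0 one_pos
  have hl : 0 < τ.lam 1 := s0.lam_pos P
  obtain ⟨p, hp, h1, h2, -, -⟩ := s0.exists_prox P h.A_zero.ge (h.near 0 one_pos)
  have h3 := h2 (h.lam_gt 0 one_pos)
  rw [zero_add] at hp
  rw [s0.y_zero h.A_zero hl.ne' h.v_zero] at hp h1 h3
  have h4 := hp x₀
  rw [real_inner_self_eq_norm_sq] at h4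
  obtain ⟨u, -, -, hmin⟩ := exists_eq_ballMin P.lipschitz.continuous P.R_pos.le x₀
  have h5 := hmin p (mem_closedBall_iff_norm'.2 (h1.le.trans P.r_le))
  have h6 := pow_le_pow_left₀ (by linarith [P.r_pos] : 0 ≤ 3 * r / 4) h3 2
  have h7 := mul_le_mul_of_nonneg_left h6 hl.le
  have h8 : 0 ≤ τ.lam 1 * r ^ 2 := by positivity
  linarith [le_max_left (f x₀ - ballMin f x₀ R) ε]

theorem Trace.Run.iterations_le (h : τ.Run O Lf R r ε x₀ N) (P : Problem f O Lf R r ε)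
    (hn : ∀ t < N, ¬ τ.Stops R r ε t) :
    (N : ℝ) + 1 ≤ 4 * (R / r) ^ (2 / 3 : ℝ)
      * (1 + Real.log (max (f x₀ - ballMin f x₀ R) ε * R / (ε * r))) := by
  have hr := P.r_pos
  have hR := P.R_pos
  have hε := P.eps_pos
  have hQ := one_le_rpow_div hr P.r_le
  have hM1 := one_le_max_mul_div hr P.r_le hε (f x₀ - ballMin f x₀ R)
  have hL := Real.log_nonneg hM1
  set Q := (R / r) ^ (2 / 3 : ℝ) with hQdef
  cases N with
  | zero =>
    push_cast
    nlinarith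
  | succ k =>
    have hlam := (h.mono (by omega)).lam_one_le P
    have hA1 := (h.step 0 k.succ_pos).A_one h.A_zero
    have hl1 : 0 < τ.lam 1 := (h.step 0 k.succ_pos).lam_pos P
    have h1 := hn k k.lt_succ_self
    simp only [Trace.Stops, not_or, not_lt, not_le] at h1
    have hqQ : r ^ (2 / 3 : ℝ) / R ^ (2 / 3 : ℝ) = Q⁻¹ := by
      rw [hQdef, Real.div_rpow hR.le hr.le, inv_div]
    have h2 := h1.2.2.2.trans_lt h1.1
    rw [hqQ, hA1, mul_one_div, div_lt_div_iff₀ hl1 hε] at h2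
    set M := max (f x₀ - ballMin f x₀ R) ε with hM
    have hMε : ε ≤ M := le_max_right _ _
    have hM0 : 0 < M := hε.trans_le hMε
    -- The natural bound `2 M R² / (ε r²)` is weakened by `M ≥ ε` to a square of the quantity in the
    -- statement.
    have h3 : Real.exp (Q⁻¹ * ((k : ℝ) - 1)) ≤ 2 * (M * R / (ε * r)) ^ 2 := by
      rw [div_pow, mul_div_assoc', le_div_iff₀ (by positivity)]
      have h4 : Real.exp (Q⁻¹ * ((k : ℝ) - 1)) * ε * (ε * r ^ 2)
          ≤ R ^ 2 * τ.lam 1 * (ε * r ^ 2) := by gcongr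
      have h5 : R ^ 2 * ε * (τ.lam 1 * r ^ 2) ≤ R ^ 2 * ε * (2 * M) := by gcongr
      have h6 : R ^ 2 * (2 * M) * ε ≤ R ^ 2 * (2 * M) * M := by gcongr
      linarith
    have h4 := Real.log_le_log (Real.exp_pos _) h3
    rw [Real.log_exp, Real.log_mul (by norm_num) (by positivity), Real.log_pow] at h4
    have h5 := Real.log_two_lt_d9
    rw [inv_mul_le_iff₀ (by positivity)] at h4
    push_cast at h4 ⊢
    have h6 : Q * (Real.log 2 + 2 * Real.log (M * R / (ε * r)))
        ≤ Q * (1 + 2 * Real.log (M * R / (ε * r))) := by gcongr; linarith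
    have h7 := mul_nonneg (by linarith : 0 ≤ Q) hL
    linarith

theorem length_flatMap_range_le {α : Type*} (g : ℕ → List α) {b : ℝ} {n : ℕ}
    (h : ∀ t < n, ((g t).length : ℝ) ≤ b) : (((List.range n).flatMap g).length : ℝ) ≤ n * b := by
  induction n with
  | zero => simp
  | succ n ih =>
    have h1 := ih fun t ht => h t (ht.trans n.lt_succ_self)
    have h2 := h n n.lt_succ_self
    rw [List.range_succ, List.flatMap_append, List.length_append]
    simp only [List.flatMap_cons, List.flatMap_nil, List.append_nil]
    push_cast
    linarith

theorem sum_map_flatMap_range {α : Type*} (g : ℕ → List α) (F : α → ℝ) (n : ℕ) :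
    (((List.range n).flatMap g).map F).sum = ∑ t ∈ Finset.range n, ((g t).map F).sum := by
  induction n with
  | zero => simp
  | succ n ih =>
    rw [List.range_succ, List.flatMap_append, List.map_append, List.sum_append, ih,
      Finset.sum_range_succ]
    simp

theorem Trace.IsStep.length_queries_le {t : ℕ} (h : τ.IsStep O Lf R r ε x₀ t)
    (P : Problem f O Lf R r ε) :
    ((τ.queries R ε t).length : ℝ) ≤ 16 * (1 + Real.posLog (Lf * R ^ 2 / (ε * r))) := by
  have h1 := h.lam_eq.length_le P.r_pos P.r_le (NNReal.coe_pos.2 P.Lf_pos) P.eps_pos P.range_le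
  have h2 : 0 ≤ Real.posLog (Lf * R ^ 2 / (ε * r)) := Real.posLog_nonneg
  rw [Trace.queries, List.length_append]
  push_cast
  simp only [List.length_cons, List.length_nil]
  push_cast
  linarith

theorem Trace.IsStep.sum_queries_le {t : ℕ} (h : τ.IsStep O Lf R r ε x₀ t)
    (P : Problem f O Lf R r ε) :
    ((τ.queries R ε t).map fun q => 1 / √q.lam).sum
      ≤ 22 * (1 + Real.posLog (Lf * R ^ 2 / (ε * r))) * (1 / √(τ.lam (t + 1))) := by
  have h1 := h.lam_eq.sum_le P.r_pos P.r_le (NNReal.coe_pos.2 P.Lf_pos) P.eps_pos P.range_le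
  have h2 : 0 ≤ Real.posLog (Lf * R ^ 2 / (ε * r)) := Real.posLog_nonneg
  have h3 : 0 ≤ 1 / √(τ.lam (t + 1)) := by positivity
  rw [Trace.queries, List.map_append, List.sum_append]
  simp only [List.map_cons, List.map_nil, List.sum_cons, List.sum_nil, add_zero]
  nlinarith

theorem Trace.IsStep.queries_spec {t : ℕ} (h : τ.IsStep O Lf R r ε x₀ t)
    (P : Problem f O Lf R r ε) :
    ∀ q ∈ τ.queries R ε t, ε / (6 * r * R) ≤ q.lam ∧ q.lam ≤ 4 * (Lf / r) ∧
      1 / 102 * (ε / (q.lam * R)) ≤ q.acc := by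
  have hr := P.r_pos
  have hR := P.R_pos
  have hε := P.eps_pos
  obtain ⟨⟨h1, h2⟩, h3⟩ := h.lam_eq.bounds P.lamMin_pos P.range_le
  have e : 2 * (2 * Lf / r) = 4 * (Lf / r) := by ring
  rw [e] at h2 h3
  intro q hq
  rcases List.mem_append.1 hq with hq | hq
  · obtain ⟨h4, h5, h6⟩ := h3 q hq
    refine ⟨h4, h5, ?_⟩
    have hl : 0 < q.lam := P.lamMin_pos.trans_le h4
    rw [div_le_iff₀ (by positivity)] at h4
    rw [h6, mul_div_assoc', div_le_div_iff₀ (by positivity) (by norm_num)]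
    linarith
  · rw [List.mem_singleton.1 hq]
    refine ⟨h1, h2, ?_⟩
    have hl : 0 < τ.lam (t + 1) := h.lam_pos P
    have e : τ.acc R ε (t + 1) = 1 / 12 * (ε / (τ.lam (t + 1) * R)) := by
      rw [Trace.acc]; field_simp
    simp only [e]
    gcongr
    norm_num

/-- Since `√A' = √λ a`, the left side is `a / √A'`, and `√A' - √A = a / (√A' + √A)`. -/
theorem Trace.IsStep.one_div_sqrt_lam_le {t : ℕ} (h : τ.IsStep O Lf R r ε x₀ t)
    (P : Problem f O Lf R r ε) (hA : 0 ≤ τ.A t) :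
    1 / √(τ.lam (t + 1)) ≤ 2 * (√(τ.A (t + 1)) - √(τ.A t)) := by
  have hl := h.lam_pos P
  have ha := h.a_pos P
  have hA' := h.A_pos P hA
  have h1 : √(τ.A (t + 1)) = √(τ.lam (t + 1)) * τ.a (t + 1) := by
    rw [← h.lam_mul_sq P hA, Real.sqrt_mul hl.le, Real.sqrt_sq ha.le]
  have h2 := Real.sq_sqrt hA
  have h3 := Real.sq_sqrt hA'.le
  have h4 := h.A_eq
  have h5 := Real.sqrt_pos.2 hA'
  have h6 : 1 / √(τ.lam (t + 1)) = τ.a (t + 1) / √(τ.A (t + 1)) := by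
    rw [h1]
    have := Real.sqrt_pos.2 hl
    field_simp
  have h7 : √(τ.A t) ≤ √(τ.A (t + 1)) := Real.sqrt_le_sqrt (by linarith)
  rw [h6, div_le_iff₀ h5]
  nlinarith [Real.sqrt_nonneg (τ.A t)]

theorem Trace.Run.sum_one_div_sqrt_le (h : τ.Run O Lf R r ε x₀ N) (P : Problem f O Lf R r ε) :
    ∑ t ∈ Finset.range N, 1 / √(τ.lam (t + 1)) ≤ 2 * √(τ.A N) := by
  induction N with
  | zero => simp
  | succ N ih =>
    have h' := h.mono N.le_succ
    have h1 := (h.step N N.lt_succ_self).one_div_sqrt_lam_le P (h'.A_nonneg P)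
    rw [Finset.sum_range_succ]
    linarith [ih h']

theorem Trace.Run.sum_le (h : τ.Run O Lf R r ε x₀ N) (P : Problem f O Lf R r ε)
    (hn : ∀ t < N, ¬ τ.Stops R r ε t) (hs : τ.IsStep O Lf R r ε x₀ N) :
    ∑ t ∈ Finset.range (N + 1), 1 / √(τ.lam (t + 1)) ≤ 5 * (R / √ε) := by
  have hr := P.r_pos
  have hR := P.R_pos
  have hε := P.eps_pos
  have hsε := Real.sqrt_pos.2 hε
  have h1 := h.sum_one_div_sqrt_le P
  have h2 : √(τ.A N) ≤ R / √ε := by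
    cases N with
    | zero => rw [h.A_zero, Real.sqrt_zero]; positivity
    | succ N =>
      have h3 := hn N N.lt_succ_self
      simp only [Trace.Stops, not_or, not_le] at h3
      have h4 := Real.sqrt_le_sqrt h3.1.le
      rwa [Real.sqrt_div (by positivity), Real.sqrt_sq hR.le] at h4
  -- The last iteration may overshoot `R² / ε`, so it is bounded by `λ ≥ ε / (6rR)` instead of by
  -- telescoping.
  have h3 : 1 / √(τ.lam (N + 1)) ≤ 3 * (R / √ε) := by
    have hl := hs.lam_pos P
    have h4 := hs.le_lam P
    have h5 : √ε ≤ 3 * R * √(τ.lam (N + 1)) := by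
      rw [Real.sqrt_le_left (by positivity), mul_pow, Real.sq_sqrt hl.le]
      rw [div_le_iff₀ (by positivity)] at h4
      have h6 : τ.lam (N + 1) * (6 * r * R) ≤ τ.lam (N + 1) * (6 * R * R) := by
        have := P.r_le
        gcongr
      have h7 : 0 < τ.lam (N + 1) * (R * R) := by positivity
      linarith
    have := Real.sqrt_pos.2 hl
    rw [mul_div_assoc', div_le_div_iff₀ (by positivity) hsε]
    linarith
  rw [Finset.sum_range_succ]
  linarith

end Complexity

/-! ### Assembling the guarantees -/

section Main

variable {d : ℕ} {f : Pt d → ℝ} {Lf : ℝ≥0} {r R ε : ℝ} {O : ℝ → ℝ → Pt d → Pt d} {x₀ : Pt d}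
  {x : Pt d} {qs : List Query}

theorem Problem.guarantees (P : Problem f O Lf R r ε) (h : Returns f O Lf R r ε x₀ x qs) :
    f x - ballMin f x₀ R ≤ ε ∧
    (qs.length : ℝ) ≤ 110 * (R / r) ^ (2 / 3 : ℝ)
      * (1 + Real.log (max (f x₀ - ballMin f x₀ R) ε * R / (ε * r)))
      * (1 + Real.posLog (Lf * R ^ 2 / (ε * r))) ∧
    (∀ q ∈ qs, q.lam ≤ 110 * (Lf / r) ∧ 1 / 102 * (ε / (q.lam * R)) ≤ q.acc) ∧
    (ε ≤ Lf * R →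
      (∀ q ∈ qs, 1 / 102 * (ε / (r * R)) ≤ q.lam) ∧
      (qs.map (fun q => 1 / √q.lam)).sum
        ≤ 110 * (R / √ε) * (1 + Real.log (Lf * R ^ 2 / (ε * r)))) := by
  have hr := P.r_pos
  have hR := P.R_pos
  have hε := P.eps_pos
  obtain ⟨N, τ, hx0, hv0, hA0, hs, hn, hst, -, hmin, rfl⟩ := h
  obtain ⟨hrun, hnear⟩ := Trace.run_of_not_stops P hx0 hv0 hA0 hs hn
  have hp : 0 ≤ Real.posLog (Lf * R ^ 2 / (ε * r)) := Real.posLog_nonneg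
  have hspec : ∀ q ∈ (List.range (N + 1)).flatMap (τ.queries R ε),
      ε / (6 * r * R) ≤ q.lam ∧ q.lam ≤ 4 * (Lf / r) ∧
        1 / 102 * (ε / (q.lam * R)) ≤ q.acc := by
    intro q hq
    obtain ⟨t, ht, hqt⟩ := List.mem_flatMap.1 hq
    exact (hs t (Nat.lt_succ_iff.1 (List.mem_range.1 ht))).queries_spec P q hqt
  refine ⟨?_, ?_, fun q hq => ⟨?_, (hspec q hq).2.2⟩, fun hle => ⟨fun q hq => ?_, ?_⟩⟩
  · obtain ⟨u, hu, he, -⟩ := exists_eq_ballMin P.lipschitz.continuous hR.le x₀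
    obtain ⟨i, hi, hgap⟩ := hrun.exists_gap_le P hnear (hs N le_rfl) hst hu
    rw [he]
    linarith [hmin i hi]
  · have h1 := length_flatMap_range_le (τ.queries R ε) (n := N + 1)
      fun t ht => (hs t (Nat.lt_succ_iff.1 ht)).length_queries_le P
    have h2 := hrun.iterations_le P hn
    push_cast at h1
    refine h1.trans ?_
    have h3 := mul_le_mul_of_nonneg_right h2
      (by positivity : 0 ≤ 16 * (1 + Real.posLog (Lf * R ^ 2 / (ε * r))))
    refine h3.trans ?_
    have h4 : 0 ≤ (R / r) ^ (2 / 3 : ℝ)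
      * (1 + Real.log (max (f x₀ - ballMin f x₀ R) ε * R / (ε * r)))
      * (1 + Real.posLog (Lf * R ^ 2 / (ε * r))) := by
      have := Real.log_nonneg (one_le_max_mul_div hr P.r_le hε (f x₀ - ballMin f x₀ R))
      positivity
    linarith
  · have : 0 ≤ Lf / r := by positivity
    linarith [(hspec q hq).2.1]
  · refine le_trans ?_ (hspec q hq).1
    have e : ε / (6 * r * R) = 1 / 6 * (ε / (r * R)) := by field_simp
    rw [e]
    gcongr
    norm_num
  · have hW : 1 ≤ Lf * R ^ 2 / (ε * r) := by
      rw [one_le_div (by positivity)]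
      have := mul_le_mul hle P.r_le hr.le (by positivity)
      linarith
    have hpl : Real.posLog (Lf * R ^ 2 / (ε * r)) = Real.log (Lf * R ^ 2 / (ε * r)) :=
      max_eq_right (Real.log_nonneg hW)
    rw [sum_map_flatMap_range, ← hpl]
    calc ∑ t ∈ Finset.range (N + 1), ((τ.queries R ε t).map fun q => 1 / √q.lam).sum
        ≤ ∑ t ∈ Finset.range (N + 1), 22 * (1 + Real.posLog (Lf * R ^ 2 / (ε * r)))
            * (1 / √(τ.lam (t + 1))) := Finset.sum_le_sum fun t ht =>
          (hs t (Nat.lt_succ_iff.1 (Finset.mem_range.1 ht))).sum_queries_le P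
      _ = 22 * (1 + Real.posLog (Lf * R ^ 2 / (ε * r)))
            * ∑ t ∈ Finset.range (N + 1), 1 / √(τ.lam (t + 1)) := by rw [Finset.mul_sum]
      _ ≤ 22 * (1 + Real.posLog (Lf * R ^ 2 / (ε * r))) * (5 * (R / √ε)) := by
          gcongr
          exact hrun.sum_le P hn (hs N le_rfl)
      _ = _ := by ring

/-- If `ε` is so large that the range of the bisection is empty, then the starting point is good
enough and the algorithm stops after a single query. -/
theorem guarantees_of_lt (hL : LipschitzWith Lf f) (hLf : 0 < Lf) (hr : 0 < r) (hrR : r ≤ R)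
    (hε : 0 < ε) (hlt : 2 * Lf / r < ε / (6 * r * R)) (h : Returns f O Lf R r ε x₀ x qs) :
    f x - ballMin f x₀ R ≤ ε ∧
    (qs.length : ℝ) ≤ 110 * (R / r) ^ (2 / 3 : ℝ)
      * (1 + Real.log (max (f x₀ - ballMin f x₀ R) ε * R / (ε * r)))
      * (1 + Real.posLog (Lf * R ^ 2 / (ε * r))) ∧
    (∀ q ∈ qs, q.lam ≤ 110 * (Lf / r) ∧ 1 / 102 * (ε / (q.lam * R)) ≤ q.acc) ∧
    Lf * R < ε := by
  have hR : 0 < R := hr.trans_le hrR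
  have hlarge : Lf * R < ε := by
    rw [div_lt_div_iff₀ hr (by positivity)] at hlt
    have h1 : 12 * (Lf * R) < ε := lt_of_mul_lt_mul_right (by linarith) hr.le
    have : 0 < Lf * R := by positivity
    linarith
  obtain ⟨N, τ, hx0, hv0, hA0, hs, hn, hst, -, hmin, rfl⟩ := h
  obtain ⟨hlam, hqs⟩ := (hs 0 N.zero_le).lam_eq.of_lt hlt
  have hN : N = 0 := by
    by_contra hN
    refine hn 0 (Nat.pos_of_ne_zero hN) (Or.inr (Or.inl ?_))
    have e : ε / (3 * r * R) = 2 * (ε / (6 * r * R)) := by field_simp; norm_num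
    rw [hlam, e]
    linarith
  subst hN
  have hq : (List.range (0 + 1)).flatMap (τ.queries R ε) = [⟨τ.lam 1, τ.acc R ε 1⟩] := by
    simp [Trace.queries, hqs]
  rw [zero_add] at hlam
  rw [hq]
  refine ⟨?_, ?_, ?_, hlarge⟩
  · obtain ⟨u, hu, he, -⟩ := exists_eq_ballMin hL.continuous hR.le x₀
    have h1 := hmin 0 (by omega)
    rw [hx0] at h1
    have h2 := (le_abs_self _).trans (hL.dist_le_mul x₀ u)
    have h3 : (Lf : ℝ) * dist x₀ u ≤ Lf * R := by
      have := Metric.mem_closedBall'.1 hu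
      gcongr
    rw [he]
    linarith
  · have h1 := one_le_rpow_div hr hrR
    have h2 := Real.log_nonneg (one_le_max_mul_div hr hrR hε (f x₀ - ballMin f x₀ R))
    have h3 : 0 ≤ Real.posLog (Lf * R ^ 2 / (ε * r)) := Real.posLog_nonneg
    rw [List.length_singleton, Nat.cast_one]
    exact one_le_mul_of_one_le_of_one_le
      (one_le_mul_of_one_le_of_one_le (by linarith) (by linarith)) (by linarith)
  · intro q hq
    rw [List.mem_singleton.1 hq]
    have hl : 0 < τ.lam 1 := by rw [hlam]; positivity
    have e : τ.acc R ε 1 = 1 / 12 * (ε / (τ.lam 1 * R)) := by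
      rw [Trace.acc]; field_simp
    have h1 : 0 < Lf / r := by positivity
    refine ⟨?_, ?_⟩
    · simp only [hlam]
      rw [show 2 * (2 * (Lf : ℝ) / r) = 4 * (Lf / r) by ring]
      have : 0 < (Lf : ℝ) / r := by positivity
      linarith
    · simp only [e]
      gcongr
      norm_num

end Main

end BrooAccel

end

theorem mainTheorem3 :
    ∃ C c : ℝ, 0 < C ∧ 0 < c ∧
      ∀ (d : ℕ) (f : BrooAccel.Pt d → ℝ) (Lf : ℝ≥0) (R r ε : ℝ) (x₀ : BrooAccel.Pt d)
        (O : ℝ → ℝ → BrooAccel.Pt d → BrooAccel.Pt d),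
        ConvexOn ℝ Set.univ f → LipschitzWith Lf f → 0 < Lf →
        0 < r → r ≤ R → 0 < ε →
        BrooAccel.IsBROO r f O →
        (∃ (x : BrooAccel.Pt d) (qs : List BrooAccel.Query),
          BrooAccel.Returns f O Lf R r ε x₀ x qs) ∧
        ∀ (x : BrooAccel.Pt d) (qs : List BrooAccel.Query),
          BrooAccel.Returns f O Lf R r ε x₀ x qs →
          f x - BrooAccel.ballMin f x₀ R ≤ ε ∧
          (qs.length : ℝ) ≤ C * (R / r) ^ (2 / 3 : ℝ)
            * (1 + Real.log (max (f x₀ - BrooAccel.ballMin f x₀ R) ε * R / (ε * r)))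
            * (1 + Real.posLog (Lf * R ^ 2 / (ε * r))) ∧
          (∀ q ∈ qs, q.lam ≤ C * (Lf / r) ∧ c * (ε / (q.lam * R)) ≤ q.acc) ∧
          (ε ≤ Lf * R →
            (∀ q ∈ qs, c * (ε / (r * R)) ≤ q.lam) ∧
            (qs.map (fun q => 1 / √q.lam)).sum
              ≤ C * (R / √ε) * (1 + Real.log (Lf * R ^ 2 / (ε * r)))) := by
  -- `110 = 22 * 5` comes from the weighted sum; the query count needs only `4 * 16`. `102 = 6 * 17`
  -- comes from accuracy `r / 17` at `λ ≥ ε / (6rR)`.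
  refine ⟨110, 1 / 102, by norm_num, by norm_num, ?_⟩
  intro d f Lf R r ε x₀ O hf hL hLf hr hrR hε hO
  refine ⟨BrooAccel.exists_returns f hr (hr.trans_le hrR) hε hLf O x₀, fun x qs h => ?_⟩
  rcases lt_or_ge (2 * Lf / r : ℝ) (ε / (6 * r * R)) with hlt | hle
  · obtain ⟨h1, h2, h3, h4⟩ := BrooAccel.guarantees_of_lt hL hLf hr hrR hε hlt h
    exact ⟨h1, h2, h3, fun h5 => absurd h5 h4.not_ge⟩
  · exact BrooAccel.Problem.guarantees ⟨hf, hL, hLf, hr, hrR, hε, hO, hle⟩ h
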